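/- Let $B$ be an indefinite rational quaternion algebra of discriminant $D_B>1$, with canonical involution $\iota$, reduced trace $\mathrm{Trd}$ and reduced norm $\mathrm{Nrd}$, and let $\mathcal O_B\subset B$ be a maximal order. Let $\Delta<0$ be an even squarefree integer and $k=\mathbb Q(\sqrt\Delta)$, with ring of integers $o_k$, and assume that every prime dividing $D_B$ is inert in $k$. Fix an element $\theta\in\mathcal O_B$ with $\theta^2=-D_B$ and an embedding $\phi\colon o_k\to\mathcal O_B$, and write also $\phi\colon k\to B$ for its extension. Put $(y,y)_\phi:=\Delta\,\mathrm{Nrd}(y)$ for $y\in B$. For a positive integer $m$ and a fractional ideal $\mathfrak a$ of $o_k$ define $$\Omega^{\pm}(m,\mathfrak a,\phi)=\Big\{y\in\phi(\mathfrak a)^{-1}\mathcal O_B \;:\; (y,y)_\phi=\pm\frac{m}{N(\mathfrak a)}\Big\},\qquad \Omega^o(n)=\{\xi\in\mathcal O_B : \mathrm{Trd}(\xi)=0,\ \mathrm{Nrd}(\xi)=n\},$$ where $\phi(\mathfrak a)^{-1}\mathcal O_B$ is the additive group generated by the products $\phi(x)b$ with $x\in\mathfrak a^{-1}$, $b\in\mathcal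 O_B$. Let $\Omega^o(|\Delta|m^2)^{\phi\text{-pos}}$ (respectively $\Omega^o(|\Delta|m^2)^{\phi\text{-neg}}$) be the set of $\xi\in\Omega^o(|\Delta|m^2)$ such that $\xi=m\,b^{-1}\phi(\sqrt\Delta)\,b$ for some $b\in B^\times$ with $(b,b)_\phi>0$ (respectively $(b,b)_\phi<0$). For $\xi\in\Omega^o(|\Delta|m^2)$ let $i_\xi\colon k\to B$ be the embedding with $i_\xi(m\sqrt\Delta)=\xi$. The conductor $c(\xi)$ is the least positive integer $c$ with $i_\xi(\mathbb Z[c\sqrt\Delta])\subset\mathcal O_B$. The Frobenius type is $\nu(\xi,\phi)=\prod_{p\mid D_B}\nu_p(\xi,\phi)$, where $\nu_p(\xi,\phi)=1$ if $\phi$ and $i_\xi$ induce the same map $o_{k,p}/(p)\to\mathcal O_{B,p}/(\theta)$, and $\nu_p(\xi,\phi)=p$ otherwise. For a rational number $x$ let $\rho(x)$ be the number of integral ideals of $o_k$ of norm $x$ (so $\rho(x)=0$ if $x$ is not an integer). Let $\mathfrak a_1,\dots,\mathfrak a_h$ be fractional ideals representing each ideal class of $k$ exactly once. Then $\eta\mapsto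 m\,\eta^{-1}\phi(\sqrt\Delta)\,\eta$ defines maps $$f\colon\coprod_{i=1}^h\Omega^+(m,\mathfrak a_i,\phi)\to\Omega^o(|\Delta|m^2)^{\phi\text{-pos}},\qquad g\colon\coprod_{i=1}^h\Omega^-(m,\mathfrak a_i,\phi)\to\Omega^o(|\Delta|m^2)^{\phi\text{-neg}},$$ and for every $\xi$ in $\Omega^o(|\Delta|m^2)^{\phi\text{-pos}}$, respectively in $\Omega^o(|\Delta|m^2)^{\phi\text{-neg}}$, $$\# f^{-1}(\xi)=|o_k^\times|\;\rho\!\left(\frac{m}{c(\xi)\,\nu(\xi,\phi)\,|\Delta|}\right),\qquad\text{respectively}\qquad \# g^{-1}(\xi)=|o_k^\times|\;\rho\!\left(\frac{m}{c(\xi)\,\nu(\xi,\phi)\,|\Delta|}\right).$$ -/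

import Mathlib

open scoped Quaternion TensorProduct nonZeroDivisors NumberField

namespace QuatCycles

noncomputable section

/-! ### Rational quaternion algebras

A quaternion algebra over `ℚ` is written as `ℍ[ℚ, α, β]` with `α, β ≠ 0`
(`i ^ 2 = α`, `j ^ 2 = β`, `i j = - j i`); its canonical involution is `star`. -/

/-- Reduced trace `Trd(x) = x + x^ι`. -/
def trd {α β : ℚ} (x : ℍ[ℚ, α, β]) : ℚ := (x + star x).re

/-- Reduced norm `Nrd(x) = x x^ι`. -/
def nrd {α β : ℚ} (x : ℍ[ℚ, α, β]) : ℚ := (x * star x).re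

/-- `x + x^ι` is the rational number `Trd(x)`. -/
theorem coe_trd {α β : ℚ} (x : ℍ[ℚ, α, β]) :
    algebraMap ℚ ℍ[ℚ, α, β] (trd x) = x + star x := by
  ext <;> simp [trd]

/-- `x x^ι` is the rational number `Nrd(x)`. -/
theorem coe_nrd {α β : ℚ} (x : ℍ[ℚ, α, β]) :
    algebraMap ℚ ℍ[ℚ, α, β] (nrd x) = x * star x := by
  ext <;> simp [nrd] <;> ring

/-- `B` is indefinite: `B ⊗ ℝ ≃ M₂(ℝ)`. -/
def IsIndefinite (B : Type*) [Ring B] [Algebra ℚ B] : Prop :=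
  Nonempty ((ℝ ⊗[ℚ] B) ≃ₐ[ℝ] Matrix (Fin 2) (Fin 2) ℝ)

/-- `B` is ramified at `p`: `B ⊗ ℚ_p` is not a matrix algebra. -/
def IsRamifiedAt (B : Type*) [Ring B] [Algebra ℚ B] (p : ℕ) [Fact p.Prime] : Prop :=
  ¬ Nonempty ((ℚ_[p] ⊗[ℚ] B) ≃ₐ[ℚ_[p]] Matrix (Fin 2) (Fin 2) ℚ_[p])

/-- `D` is the discriminant of `B`: the product of the primes at which `B` is ramified. -/
def IsDiscriminant (B : Type*) [Ring B] [Algebra ℚ B] (D : ℕ) : Prop :=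
  Squarefree D ∧ ∀ (p : ℕ) [Fact p.Prime], p ∣ D ↔ IsRamifiedAt B p

/-- A subring of `B` is an order if it is a finitely generated `ℤ`-module that spans `B`
over `ℚ`. -/
def IsOrder {B : Type*} [Ring B] [Algebra ℚ B] (O : Subring B) : Prop :=
  O.toAddSubgroup.FG ∧ Submodule.span ℚ (O : Set B) = ⊤

/-- A maximal order. -/
def IsMaximalOrder {B : Type*} [Ring B] [Algebra ℚ B] (O : Subring B) : Prop :=
  Maximal IsOrder O

/-! ### The field `k = ℚ(√Δ)` is a quadratic field `K` with an element `s`, `s ^ 2 = Δ`. -/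

/-- `ρ(x)`: the number of integral ideals of `o_k` of norm `x` (zero if `x` is not an integer). -/
def rho (K : Type*) [Field K] [NumberField K] (x : ℚ) : ℕ :=
  Nat.card {I : Ideal (𝓞 K) // (Ideal.absNorm I : ℚ) = x}

section Cycles

variable {K : Type*} [Field K] {α β : ℚ}

/-- `Ω^o(n)`. -/
def OmegaO (O : Subring ℍ[ℚ, α, β]) (n : ℚ) : Set ℍ[ℚ, α, β] :=
  {ξ | ξ ∈ O ∧ trd ξ = 0 ∧ nrd ξ = n}

/-- The quadratic form `(y, y)_φ = Δ Nrd(y)`. -/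
def quadForm (Δ : ℤ) (y : ℍ[ℚ, α, β]) : ℚ := Δ * nrd y

/-- The lattice `φ(𝔞)⁻¹ O_B`, generated by the products `φ(x) b` with `x ∈ 𝔞⁻¹`, `b ∈ O_B`. -/
def idealLattice [NumberField K] (O : Subring ℍ[ℚ, α, β]) (φ : K →ₐ[ℚ] ℍ[ℚ, α, β])
    (𝔞 : (FractionalIdeal (𝓞 K)⁰ K)ˣ) : AddSubgroup ℍ[ℚ, α, β] :=
  AddSubgroup.closure
    {y | ∃ x ∈ ((𝔞⁻¹ : (FractionalIdeal (𝓞 K)⁰ K)ˣ) : FractionalIdeal (𝓞 K)⁰ K),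
      ∃ b ∈ O, y = φ x * b}

/-- `Ω^+(m, 𝔞, φ)`. -/
def OmegaPlus [NumberField K] (Δ : ℤ) (O : Subring ℍ[ℚ, α, β]) (φ : K →ₐ[ℚ] ℍ[ℚ, α, β])
    (m : ℕ) (𝔞 : (FractionalIdeal (𝓞 K)⁰ K)ˣ) : Set ℍ[ℚ, α, β] :=
  {y | y ∈ idealLattice O φ 𝔞 ∧
    quadForm Δ y = m / FractionalIdeal.absNorm (𝔞 : FractionalIdeal (𝓞 K)⁰ K)}

/-- `Ω^-(m, 𝔞, φ)`. -/
def OmegaMinus [NumberField K] (Δ : ℤ) (O : Subring ℍ[ℚ, α, β]) (φ : K →ₐ[ℚ] ℍ[ℚ, α, β])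
    (m : ℕ) (𝔞 : (FractionalIdeal (𝓞 K)⁰ K)ˣ) : Set ℍ[ℚ, α, β] :=
  {y | y ∈ idealLattice O φ 𝔞 ∧
    quadForm Δ y = -(m / FractionalIdeal.absNorm (𝔞 : FractionalIdeal (𝓞 K)⁰ K))}

/-- `Ω^o(|Δ| m²)^{φ-pos}`. -/
def OmegaPos (Δ : ℤ) (s : K) [Algebra ℚ K] (O : Subring ℍ[ℚ, α, β])
    (φ : K →ₐ[ℚ] ℍ[ℚ, α, β]) (m : ℕ) : Set ℍ[ℚ, α, β] :=
  {ξ | ξ ∈ OmegaO O (|Δ| * m ^ 2) ∧ ∃ b : (ℍ[ℚ, α, β])ˣ,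
    0 < quadForm Δ (b : ℍ[ℚ, α, β]) ∧ ξ = m * (↑b⁻¹ * φ s * b)}

/-- `Ω^o(|Δ| m²)^{φ-neg}`. -/
def OmegaNeg (Δ : ℤ) (s : K) [Algebra ℚ K] (O : Subring ℍ[ℚ, α, β])
    (φ : K →ₐ[ℚ] ℍ[ℚ, α, β]) (m : ℕ) : Set ℍ[ℚ, α, β] :=
  {ξ | ξ ∈ OmegaO O (|Δ| * m ^ 2) ∧ ∃ b : (ℍ[ℚ, α, β])ˣ,
    quadForm Δ (b : ℍ[ℚ, α, β]) < 0 ∧ ξ = m * (↑b⁻¹ * φ s * b)}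

/-- The map `η ↦ m η⁻¹ φ(√Δ) η` (`Ring.inverse η` is the inverse of `η` if `η` is a unit, as is
every `η` of nonzero reduced norm). -/
def conjMap (s : K) [Algebra ℚ K] (φ : K →ₐ[ℚ] ℍ[ℚ, α, β]) (m : ℕ) (η : ℍ[ℚ, α, β]) :
    ℍ[ℚ, α, β] :=
  m * (Ring.inverse η * φ s * η)

/-- `i` is the embedding `i_ξ : k → B` induced by `ξ ∈ Ω^o(|Δ| t²)`, that is,
`i(t √Δ) = ξ`. See `existsUnique_isInduced`. -/
def IsInduced (s : K) [Algebra ℚ K] (t : ℕ) (ξ : ℍ[ℚ, α, β]) (i : K →ₐ[ℚ] ℍ[ℚ, α, β]) : Prop :=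
  i (t * s) = ξ

/-- The conductor `c(ξ)` of `ξ ∈ Ω^o(|Δ| t²)`: the least positive integer `c` such that
`i_ξ(o_c) ⊆ O_B`, where `o_c = ℤ[c √Δ]`. -/
def conductor (s : K) [Algebra ℚ K] (O : Subring ℍ[ℚ, α, β]) (t : ℕ) (ξ : ℍ[ℚ, α, β]) : ℕ :=
  sInf {c : ℕ | 0 < c ∧ ∃ i : K →ₐ[ℚ] ℍ[ℚ, α, β], IsInduced s t ξ i ∧
    ∀ x ∈ Algebra.adjoin ℤ {(c : K) * s}, i x ∈ O}

/-- The local order `O_{B,p} = O_B ⊗ ℤ_p` inside `B ⊗ ℚ_p`. -/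
def localOrder (O : Subring ℍ[ℚ, α, β]) (p : ℕ) [Fact p.Prime] :
    Submodule ℤ_[p] (ℚ_[p] ⊗[ℚ] ℍ[ℚ, α, β]) :=
  Submodule.span ℤ_[p] ((fun b => (1 : ℚ_[p]) ⊗ₜ[ℚ] b) '' (O : Set ℍ[ℚ, α, β]))

/-- The embeddings `i, j : k → B` have the same reduction `o_{k,p} / (p) → O_{B,p} / (θ)`: the
elements `i(a)` and `j(a)` are congruent modulo `θ O_{B,p}` for all `a ∈ o_k`
(whose classes exhaust `o_{k,p} / (p)`). -/
def SameReduction (O : Subring ℍ[ℚ, α, β]) (θ : ℍ[ℚ, α, β]) [Algebra ℚ K]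
    (i j : K →ₐ[ℚ] ℍ[ℚ, α, β]) (p : ℕ) [Fact p.Prime] : Prop :=
  ∀ a : 𝓞 K, ∃ x ∈ localOrder O p,
    (1 : ℚ_[p]) ⊗ₜ[ℚ] (i a - j a) = ((1 : ℚ_[p]) ⊗ₜ[ℚ] θ) * x

open Classical in
/-- The local Frobenius type `ν_p(ξ, φ)`: it is `1` if `φ` and `i_ξ` have the same reduction
at `p`, and `p` otherwise. -/
def localFrobeniusType (s : K) [Algebra ℚ K] (O : Subring ℍ[ℚ, α, β]) (θ : ℍ[ℚ, α, β])
    (φ : K →ₐ[ℚ] ℍ[ℚ, α, β]) (t : ℕ) (ξ : ℍ[ℚ, α, β]) (p : ℕ) [Fact p.Prime] : ℕ :=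
  if ∃ i : K →ₐ[ℚ] ℍ[ℚ, α, β], IsInduced s t ξ i ∧ SameReduction O θ φ i p then 1 else p

/-- The Frobenius type `ν(ξ, φ) = ∏_{p ∣ D} ν_p(ξ, φ)` of `ξ ∈ Ω^o(|Δ| t²)` relative to `φ`. -/
def frobeniusType (s : K) [Algebra ℚ K] (O : Subring ℍ[ℚ, α, β]) (θ : ℍ[ℚ, α, β]) (D : ℕ)
    (φ : K →ₐ[ℚ] ℍ[ℚ, α, β]) (t : ℕ) (ξ : ℍ[ℚ, α, β]) : ℕ :=
  ∏ p ∈ D.primeFactors.attach,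
    haveI : Fact (p : ℕ).Prime := ⟨Nat.prime_of_mem_primeFactors p.2⟩
    localFrobeniusType s O θ φ t ξ p

/-- The embedding induced by `ξ ∈ Ω^o(|Δ| t²)` exists and is unique, so that `conductor` and
`frobeniusType` refer to a well determined embedding. -/
theorem existsUnique_isInduced [NumberField K] (Δ : ℤ) (hΔ : Δ < 0) (s : K)
    (hs : s ^ 2 = (Δ : K)) (hK : Module.finrank ℚ K = 2) (O : Subring ℍ[ℚ, α, β])
    (t : ℕ) (ht : 0 < t) (ξ : ℍ[ℚ, α, β]) (hξ : ξ ∈ OmegaO O (|Δ| * t ^ 2)) :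
    ∃! i : K →ₐ[ℚ] ℍ[ℚ, α, β], IsInduced s t ξ i := by
  have ht0 : (t : ℚ) ≠ 0 := by positivity
  have hnot : ∀ q : ℚ, algebraMap ℚ K q ≠ s := by
    intro q hq
    have h1 : algebraMap ℚ K (q ^ 2) = algebraMap ℚ K (Δ : ℚ) := by
      rw [map_pow, hq, hs]; simp
    have h2 : q ^ 2 = (Δ : ℚ) := (algebraMap ℚ K).injective h1
    have h3 : (Δ : ℚ) < 0 := by exact_mod_cast hΔ
    nlinarith [sq_nonneg q]
  have htop : Algebra.adjoin ℚ {s} = ⊤ := by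
    have : IsSimpleOrder (Subalgebra ℚ K) :=
      Subalgebra.isSimpleOrder_of_finrank_prime ℚ K (hK ▸ Nat.prime_two)
    rcases eq_bot_or_eq_top (Algebra.adjoin ℚ {s}) with h | h
    · exfalso
      have : s ∈ (⊥ : Subalgebra ℚ K) := h ▸ Algebra.subset_adjoin rfl
      obtain ⟨q, hq⟩ := Algebra.mem_bot.mp this
      exact hnot q hq
    · exact h
  have hint : IsIntegral ℚ s := Algebra.IsIntegral.isIntegral s
  let pb := PowerBasis.ofAdjoinEqTop hint htop
  have hgen : pb.gen = s := PowerBasis.ofAdjoinEqTop_gen hint htop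
  have hmin : minpoly ℚ s = Polynomial.X ^ 2 - Polynomial.C (Δ : ℚ) := by
    symm
    apply minpoly.eq_of_irreducible_of_monic
    · refine (Polynomial.irreducible_iff_roots_eq_zero_of_degree_le_three ?_ ?_).2 ?_
      · rw [Polynomial.natDegree_X_pow_sub_C]
      · rw [Polynomial.natDegree_X_pow_sub_C]; norm_num
      · rw [Multiset.eq_zero_iff_forall_notMem]
        intro q hq
        have h := Polynomial.isRoot_of_mem_roots hq
        simp only [Polynomial.IsRoot.def, Polynomial.eval_sub, Polynomial.eval_pow,
          Polynomial.eval_X, Polynomial.eval_C] at h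
        have h3 : (Δ : ℚ) < 0 := by exact_mod_cast hΔ
        nlinarith [sq_nonneg q]
    · simp [hs]
    · exact Polynomial.monic_X_pow_sub_C _ two_ne_zero
  have hstar : star ξ = -ξ := by
    have h := coe_trd ξ
    rw [hξ.2.1, map_zero] at h
    exact eq_neg_of_add_eq_zero_right h.symm
  have hsq : ξ * ξ = algebraMap ℚ ℍ[ℚ, α, β] ((Δ : ℚ) * t ^ 2) := by
    have h := coe_nrd ξ
    rw [hξ.2.2, hstar, mul_neg] at h
    have habs : |(Δ : ℚ)| = -(Δ : ℚ) := abs_of_neg (by exact_mod_cast hΔ)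
    have hc : (((|Δ| : ℤ) : ℚ)) = -(Δ : ℚ) := by rw [Int.cast_abs, habs]
    rw [hc, neg_mul, map_neg] at h
    exact (neg_injective h).symm
  let y : ℍ[ℚ, α, β] := (t : ℚ)⁻¹ • ξ
  have hy2 : y ^ 2 = algebraMap ℚ ℍ[ℚ, α, β] (Δ : ℚ) := by
    simp only [y, pow_two, smul_mul_assoc, mul_smul_comm, hsq, smul_smul]
    rw [Algebra.algebraMap_eq_smul_one, Algebra.algebraMap_eq_smul_one, smul_smul]
    congr 1
    field_simp
  have hy : Polynomial.aeval y (minpoly ℚ pb.gen) = 0 := by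
    rw [hgen, hmin]
    simp [hy2]
  refine ⟨pb.lift y hy, ?_, ?_⟩
  · have h := pb.lift_gen y hy
    rw [hgen] at h
    simp only [IsInduced, map_mul, map_natCast, h, y]
    rw [← map_natCast (algebraMap ℚ ℍ[ℚ, α, β]) t, ← Algebra.smul_def, smul_smul,
      mul_inv_cancel₀ ht0, one_smul]
  · intro j hj
    apply pb.algHom_ext
    rw [pb.lift_gen y hy, hgen]
    simp only [y]
    have hj' : j (t * s) = ξ := hj
    rw [← hj', map_mul, map_natCast, ← map_natCast (algebraMap ℚ ℍ[ℚ, α, β]) t,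
      ← Algebra.smul_def, smul_smul, inv_mul_cancel₀ ht0, one_smul]

end Cycles

end

end QuatCycles

/-!
Let `ξ = m b⁻¹ φ(√Δ) b`. An element `η` has image `ξ` exactly when `η = φ(x) b` for some `x ∈ k`.
Let `J` be the fractional ideal of all `x` with `φ(x) b ∈ O`. Then `φ(x) b` lies in
`φ(𝔞)⁻¹ O` exactly when `x 𝔞 = J I` for an integral ideal `I`, and since the norm form of `k` is
positive, the equation `(φ(x) b, φ(x) b)_φ = ± m / N(𝔞)` becomes `N(I) = m / (N(J) |Nrd b| |Δ|)`.
As each ideal class contains exactly one `𝔞ᵢ`, every such `I` arises from `|o_k^×|` pairs `(i, x)`.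

It remains to see that `N(J) |Nrd b| = c(ξ) ν(ξ, φ)`. The left side is unchanged when `b` is
replaced by `φ(x) b`, so that it can be computed prime by prime, with `b ∈ O` not divisible by `p`
from the left in `φ(o_k)`. If `p ∤ D`, the order is a matrix ring at `p` and only the conductor
contributes. If `p ∣ D`, the order is at `p` the valuation ring of a division algebra, `p` does not
divide the conductor, and `b` is a unit or a uniformizer times a unit according to whether
`φ` and `i_ξ` have the same reduction or not.
-/

namespace QuatCycles

section Quaternion

variable {α β : ℚ}

theorem nrd_eq (x : ℍ[ℚ,α,β]) :
    nrd x = x.re ^ 2 - α * x.imI ^ 2 - β * x.imJ ^ 2 + α * β * x.imK ^ 2 := by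
  simp [nrd]; ring

theorem trd_eq (x : ℍ[ℚ,α,β]) : trd x = 2 * x.re := by
  simp [trd]; ring

@[simp] theorem nrd_mul (x y : ℍ[ℚ,α,β]) : nrd (x * y) = nrd x * nrd y := by
  simp only [nrd_eq, QuaternionAlgebra.re_mul, QuaternionAlgebra.imI_mul,
    QuaternionAlgebra.imJ_mul, QuaternionAlgebra.imK_mul]
  ring

@[simp] theorem nrd_one : nrd (1 : ℍ[ℚ,α,β]) = 1 := by simp [nrd_eq]

@[simp] theorem nrd_zero : nrd (0 : ℍ[ℚ,α,β]) = 0 := by simp [nrd_eq]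

@[simp] theorem nrd_smul (q : ℚ) (x : ℍ[ℚ,α,β]) : nrd (q • x) = q ^ 2 * nrd x := by
  simp [nrd_eq]; ring

@[simp] theorem nrd_star (x : ℍ[ℚ,α,β]) : nrd (star x) = nrd x := by
  simp [nrd_eq]

@[simp] theorem trd_smul (q : ℚ) (x : ℍ[ℚ,α,β]) : trd (q • x) = q * trd x := by
  simp [trd_eq]; ring

@[simp] theorem trd_add (x y : ℍ[ℚ,α,β]) : trd (x + y) = trd x + trd y := by
  simp [trd_eq]; ring

@[simp] theorem trd_one : trd (1 : ℍ[ℚ,α,β]) = 2 := by simp [trd_eq]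

theorem star_mul_self_eq (x : ℍ[ℚ,α,β]) : star x * x = nrd x • 1 := by
  ext <;> simp [nrd_eq] <;> ring

theorem mul_star_self_eq (x : ℍ[ℚ,α,β]) : x * star x = nrd x • 1 := by
  ext <;> simp [nrd_eq] <;> ring

theorem star_eq_trd_sub (x : ℍ[ℚ,α,β]) : star x = trd x • 1 - x := by
  ext <;> simp [trd_eq]; ring

theorem mul_self_eq (x : ℍ[ℚ,α,β]) : x * x = trd x • x - nrd x • 1 := by
  rw [← star_mul_self_eq, star_eq_trd_sub, sub_mul, smul_mul_assoc, one_mul]; abel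

theorem isUnit_of_nrd_ne_zero {x : ℍ[ℚ,α,β]} (h : nrd x ≠ 0) : IsUnit x := by
  refine ⟨⟨x, (nrd x)⁻¹ • star x, ?_, ?_⟩, rfl⟩
  · rw [mul_smul_comm, mul_star_self_eq, smul_smul, inv_mul_cancel₀ h, one_smul]
  · rw [smul_mul_assoc, star_mul_self_eq, smul_smul, inv_mul_cancel₀ h, one_smul]

theorem nrd_unit_ne_zero (b : (ℍ[ℚ,α,β])ˣ) : nrd (b : ℍ[ℚ,α,β]) ≠ 0 := fun h => by
  simpa [h] using (nrd_mul (b : ℍ[ℚ,α,β]) ↑b⁻¹).symm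

theorem coe_inv_eq (b : (ℍ[ℚ,α,β])ˣ) :
    ((b⁻¹ : (ℍ[ℚ,α,β])ˣ) : ℍ[ℚ,α,β]) = (nrd (b : ℍ[ℚ,α,β]))⁻¹ • star (b : ℍ[ℚ,α,β]) := by
  refine Units.inv_eq_of_mul_eq_one_right ?_
  rw [mul_smul_comm, mul_star_self_eq, smul_smul, inv_mul_cancel₀ (nrd_unit_ne_zero b), one_smul]

theorem nrd_coe_inv (b : (ℍ[ℚ,α,β])ˣ) :
    nrd ((b⁻¹ : (ℍ[ℚ,α,β])ˣ) : ℍ[ℚ,α,β]) = (nrd (b : ℍ[ℚ,α,β]))⁻¹ := by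
  refine eq_inv_of_mul_eq_one_left ?_
  rw [← nrd_mul, Units.inv_mul, nrd_one]

variable (α β) in
/-- The reduced trace form `(x, y) ↦ Trd(x y)`. -/
noncomputable def trdForm : LinearMap.BilinForm ℚ ℍ[ℚ,α,β] :=
  LinearMap.mk₂ ℚ (fun x y => trd (x * y)) (by simp [add_mul]) (by simp) (by simp [mul_add])
    (by simp)

theorem trdForm_apply (x y : ℍ[ℚ,α,β]) : trdForm α β x y = trd (x * y) := rfl

theorem trdForm_isSymm : (trdForm α β).IsSymm :=
  ⟨fun x y => by simp [trdForm_apply, trd_eq]; ring⟩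

theorem trdForm_nondegenerate (hα : α ≠ 0) (hβ : β ≠ 0) : (trdForm α β).Nondegenerate := by
  refine (LinearMap.BilinForm.IsSymm.isRefl trdForm_isSymm).nondegenerate_iff_separatingLeft.2 ?_
  intro x hx
  have h1 := hx ⟨1, 0, 0, 0⟩
  have hI := hx ⟨0, 1, 0, 0⟩
  have hJ := hx ⟨0, 0, 1, 0⟩
  have hK := hx ⟨0, 0, 0, 1⟩
  simp only [trdForm_apply, trd_eq, QuaternionAlgebra.re_mul] at h1 hI hJ hK
  ext <;> simp_all

end Quaternion

section Orders

theorem isIntegral_star {A : Type*} [Ring A] [StarRing A] {x : A} (hx : IsIntegral ℤ x) :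
    IsIntegral ℤ (star x) := by
  obtain ⟨P, hP, hx⟩ := hx
  refine ⟨P, hP, ?_⟩
  have := congr(star $hx)
  simpa [Polynomial.eval₂_eq_sum_range, star_sum, star_mul, (Int.cast_commute _ _).eq] using this

variable {B : Type*} [Ring B] [Algebra ℚ B] {O : Subring B}

theorem intCast_smul_mem {x : B} (n : ℤ) (hx : x ∈ O) : (n : ℚ) • x ∈ O := by
  rw [Int.cast_smul_eq_zsmul]; exact zsmul_mem hx n

theorem natCast_smul_mem {x : B} (n : ℕ) (hx : x ∈ O) : (n : ℚ) • x ∈ O := by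
  simpa using intCast_smul_mem (n : ℤ) hx

namespace IsOrder

theorem exists_natCast_smul_mem (hO : IsOrder O) (x : B) : ∃ M : ℕ, 0 < M ∧ (M : ℚ) • x ∈ O := by
  have hx : x ∈ Submodule.span ℚ (O : Set B) := hO.2 ▸ Submodule.mem_top
  induction hx using Submodule.span_induction with
  | mem x hx => exact ⟨1, one_pos, by simpa using hx⟩
  | zero => exact ⟨1, one_pos, by simp⟩
  | add x y _ _ hx hy =>
    obtain ⟨M, hM, hx⟩ := hx
    obtain ⟨N, hN, hy⟩ := hy
    refine ⟨M * N, Nat.mul_pos hM hN, ?_⟩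
    have h : ((M * N : ℕ) : ℚ) • (x + y) = (N : ℚ) • (M : ℚ) • x + (M : ℚ) • (N : ℚ) • y := by
      push_cast; module
    exact h ▸ add_mem (natCast_smul_mem N hx) (natCast_smul_mem M hy)
  | smul q x _ hx =>
    obtain ⟨M, hM, hx⟩ := hx
    refine ⟨M * q.den, Nat.mul_pos hM q.pos, ?_⟩
    have h : ((M * q.den : ℕ) : ℚ) • q • x = (q.num : ℚ) • (M : ℚ) • x := by
      rw [smul_smul, smul_smul, Nat.cast_mul, mul_assoc, Rat.den_mul_eq_num, mul_comm]
    exact h ▸ intCast_smul_mem q.num hx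

theorem isIntegral (hO : IsOrder O) {x : B} (hx : x ∈ O) : IsIntegral ℤ x := by
  refine .of_mem_of_fg (subalgebraOfSubring O) ?_ x hx
  rw [Submodule.fg_iff_addSubgroup_fg]
  exact hO.1

theorem exists_int_of_smul_one_mem [Nontrivial B] (hO : IsOrder O) {q : ℚ}
    (h : q • (1 : B) ∈ O) : ∃ n : ℤ, q = n := by
  have hq : IsIntegral ℤ q := by
    rw [← isIntegral_algHom_iff ((Algebra.ofId ℚ B).restrictScalars ℤ)
      (FaithfulSMul.algebraMap_injective ℚ B)]
    simpa [Algebra.ofId_apply, Algebra.algebraMap_eq_smul_one] using hO.isIntegral h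
  obtain ⟨n, rfl⟩ := IsIntegrallyClosed.isIntegral_iff.1 hq
  exact ⟨n, rfl⟩

end IsOrder

variable {α β : ℚ}

open Algebra in
theorem isIntegral_trd_and_nrd {x : ℍ[ℚ,α,β]} (hx : IsIntegral ℤ x) :
    IsIntegral ℤ (trd x) ∧ IsIntegral ℤ (nrd x) := by
  let C := adjoin ℚ {x}
  let y : C := ⟨x, self_mem_adjoin_singleton ℚ x⟩
  let z : C := algebraMap ℚ C (trd x) - y
  have hval : Function.Injective (C.val.restrictScalars ℤ) := Subtype.val_injective
  have hy : IsIntegral ℤ y := (isIntegral_algHom_iff _ hval).1 hx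
  have hz : IsIntegral ℤ z := (isIntegral_algHom_iff _ hval).1 <| by
    simpa [z, y, star_eq_trd_sub, algebraMap_eq_smul_one] using isIntegral_star hx
  have hinj : Function.Injective ((ofId ℚ C).restrictScalars ℤ) :=
    FaithfulSMul.algebraMap_injective ℚ C
  rw [← isIntegral_algHom_iff _ hinj, ← isIntegral_algHom_iff _ hinj (x := nrd x)]
  refine ⟨by simpa [z, ofId_apply] using hy.add hz, ?_⟩
  have hyz : (ofId ℚ C).restrictScalars ℤ (nrd x) = y * z := Subtype.ext <| by
    simp [ofId_apply, z, y, ← star_eq_trd_sub, mul_star_self_eq, algebraMap_eq_smul_one]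
  exact hyz ▸ hy.mul hz

namespace IsOrder

variable {O : Subring ℍ[ℚ,α,β]}

theorem exists_trd_eq (hO : IsOrder O) {x : ℍ[ℚ,α,β]} (hx : x ∈ O) : ∃ n : ℤ, trd x = n :=
  (IsIntegrallyClosed.isIntegral_iff.1 (isIntegral_trd_and_nrd (hO.isIntegral hx)).1).imp
    fun _ h => h.symm

theorem exists_nrd_eq (hO : IsOrder O) {x : ℍ[ℚ,α,β]} (hx : x ∈ O) : ∃ n : ℤ, nrd x = n :=
  (IsIntegrallyClosed.isIntegral_iff.1 (isIntegral_trd_and_nrd (hO.isIntegral hx)).2).imp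
    fun _ h => h.symm

theorem star_mem (hO : IsOrder O) {x : ℍ[ℚ,α,β]} (hx : x ∈ O) : star x ∈ O := by
  obtain ⟨t, ht⟩ := hO.exists_trd_eq hx
  rw [star_eq_trd_sub, ht]
  exact sub_mem (intCast_smul_mem t O.one_mem) hx

/-- A ring with integral reduced traces lies in the dual, under the trace form, of any lattice it
contains. -/
theorem of_trd_integral (hα : α ≠ 0) (hβ : β ≠ 0) (hspan : Submodule.span ℚ (O : Set ℍ[ℚ,α,β]) = ⊤)
    (htr : ∀ x ∈ O, ∃ n : ℤ, trd x = n) : IsOrder O := by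
  classical
  refine ⟨?_, hspan⟩
  obtain ⟨s, hsO, hs, hli⟩ := exists_linearIndependent ℚ (O : Set ℍ[ℚ,α,β])
  let b : Module.Basis s ℚ ℍ[ℚ,α,β] := .mk hli (by simp [hs, hspan])
  have : Finite s := Module.Finite.finite_basis b
  have hle : AddSubgroup.toIntSubmodule O.toAddSubgroup ≤
      (trdForm α β).dualSubmodule (Submodule.span ℤ (Set.range b)) := by
    intro x hx y hy
    have hyO : y ∈ AddSubgroup.toIntSubmodule O.toAddSubgroup := by
      refine Submodule.span_le.2 ?_ hy
      rintro _ ⟨i, rfl⟩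
      simpa [b] using hsO i.2
    obtain ⟨n, hn⟩ := htr _ (mul_mem (show x ∈ O from hx) hyO)
    exact Submodule.mem_one.2 ⟨n, hn.symm⟩
  rw [LinearMap.BilinForm.dualSubmodule_span_of_basis _ (trdForm_nondegenerate hα hβ)] at hle
  have h := Submodule.FG.of_le (Submodule.fg_span (R := ℤ) (Set.finite_range _)) hle
  simpa using (Submodule.fg_iff_addSubgroup_fg _).1 h

end IsOrder

theorem IsMaximalOrder.eq_of_trd_integral (hα : α ≠ 0) (hβ : β ≠ 0) {O O' : Subring ℍ[ℚ,α,β]}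
    (hO : IsMaximalOrder O) (hle : O ≤ O') (htr : ∀ x ∈ O', ∃ n : ℤ, trd x = n) : O' = O :=
  hO.eq_of_ge (.of_trd_integral hα hβ
    (top_le_iff.1 (hO.prop.2.symm.le.trans (Submodule.span_mono hle))) htr) hle

end Orders

section QuadraticExtension

theorem sq_eq_trace_smul_sub_norm_smul {R S : Type*} [CommRing R] [Nontrivial R] [CommRing S]
    [Algebra R S] [Module.Free R S] (hS : Module.finrank R S = 2) (x : S) :
    x ^ 2 = Algebra.trace R S x • x - Algebra.norm R x • 1 := by
  have : Module.Finite R S := Module.finite_of_finrank_pos (by simp [hS])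
  let b := Module.finBasisOfFinrankEq R S hS
  apply Algebra.leftMulMatrix_injective b
  have h := Matrix.aeval_self_charpoly (Algebra.leftMulMatrix b x)
  rw [Matrix.charpoly_fin_two, ← Algebra.trace_eq_matrix_trace b,
    ← Algebra.norm_eq_matrix_det b] at h
  simp only [map_add, map_sub, map_mul, map_pow, Polynomial.aeval_X, Polynomial.aeval_C,
    Algebra.algebraMap_eq_smul_one, smul_mul_assoc, one_mul] at h
  rw [map_pow, map_sub, map_smul, map_smul, map_one]
  linear_combination (norm := module) h

variable {F K : Type*} [Field F] [Field K] [Algebra F K]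

theorem trace_eq_and_norm_eq_of_sq_eq (hK : Module.finrank F K = 2) {x : K}
    (hx : x ∉ Set.range (algebraMap F K)) {t n : F} (h : x ^ 2 = t • x - n • 1) :
    Algebra.trace F K x = t ∧ Algebra.norm F x = n := by
  have h0 : (Algebra.trace F K x - t) • x = (Algebra.norm F x - n) • (1 : K) := by
    linear_combination (norm := module) h - sq_eq_trace_smul_sub_norm_smul hK x
  have ht : Algebra.trace F K x - t = 0 := by
    by_contra hne
    refine hx ⟨(Algebra.trace F K x - t)⁻¹ * (Algebra.norm F x - n), ?_⟩
    rw [Algebra.algebraMap_eq_smul_one, mul_smul, ← h0, inv_smul_smul₀ hne]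
  rw [ht, zero_smul] at h0
  exact ⟨sub_eq_zero.1 ht, sub_eq_zero.1 ((smul_eq_zero.1 h0.symm).resolve_right one_ne_zero)⟩

theorem trd_map_and_nrd_map {α β : ℚ} {K : Type*} [Field K] [Algebra ℚ K]
    (hK : Module.finrank ℚ K = 2) (φ : K →ₐ[ℚ] ℍ[ℚ,α,β]) (x : K) :
    trd (φ x) = Algebra.trace ℚ K x ∧ nrd (φ x) = Algebra.norm ℚ x := by
  by_cases hx : x ∈ Set.range (algebraMap ℚ K)
  · obtain ⟨q, rfl⟩ := hx
    rw [Algebra.trace_algebraMap, Algebra.norm_algebraMap, hK, AlgHom.commutes,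
      Algebra.algebraMap_eq_smul_one, trd_smul, nrd_smul, trd_one, nrd_one]
    simp [mul_comm]
  · have h := trace_eq_and_norm_eq_of_sq_eq hK hx (t := trd (φ x)) (n := nrd (φ x))
      (φ.toRingHom.injective (by simpa [sq] using mul_self_eq (φ x)))
    exact ⟨h.1.symm, h.2.symm⟩

end QuadraticExtension

section NumberField

variable {K : Type*} [Field K] [NumberField K]

theorem finite_units_of_rank_eq_zero (h : NumberField.Units.rank K = 0) : Finite (𝓞 K)ˣ := by
  have : IsEmpty (Fin (NumberField.Units.rank K)) := by rw [h]; infer_instance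
  refine Finite.of_surjective
    ((↑) : NumberField.Units.torsion K → (𝓞 K)ˣ) fun u => ?_
  obtain ⟨⟨ζ, e⟩, hu, -⟩ := NumberField.Units.exist_unique_eq_mul_prod K u
  exact ⟨ζ, by simpa using hu.symm⟩

theorem dvd_of_dvd_norm {p : ℕ} (hK : Module.finrank ℚ K = 2)
    (hp : (Ideal.span {(p : 𝓞 K)}).IsPrime) {x : 𝓞 K} (hx : (p : ℤ) ∣ Algebra.norm ℤ x) :
    (p : 𝓞 K) ∣ x := by
  have hsq (z : 𝓞 K) := sq_eq_trace_smul_sub_norm_smul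
    ((NumberField.RingOfIntegers.rank K).trans hK) z
  obtain ⟨n, hn⟩ := hx
  have hmul : x * (Algebra.trace ℤ (𝓞 K) x - x) = p * n := by
    have := hsq x
    rw [hn, zsmul_eq_mul, zsmul_eq_mul] at this
    push_cast at this
    linear_combination -this
  rcases hp.mem_or_mem (Ideal.mem_span_singleton.2 ⟨(n : 𝓞 K), hmul⟩) with h | h
  · exact Ideal.mem_span_singleton.1 h
  · obtain ⟨y, hy⟩ := Ideal.mem_span_singleton.1 h
    refine ⟨(Algebra.trace ℤ (𝓞 K) y : ℤ) - y, ?_⟩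
    have htr_int : Algebra.trace ℤ (𝓞 K) (Algebra.trace ℤ (𝓞 K) x : 𝓞 K) =
        2 * Algebra.trace ℤ (𝓞 K) x := by
      simpa [NumberField.RingOfIntegers.rank, hK] using
        Algebra.trace_algebraMap (R := ℤ) (S := 𝓞 K) (Algebra.trace ℤ (𝓞 K) x)
    have htr_mul : Algebra.trace ℤ (𝓞 K) (p * y) = p * Algebra.trace ℤ (𝓞 K) y := by
      simpa using map_smul (Algebra.trace ℤ (𝓞 K)) (p : ℤ) y
    have htr := congr(Algebra.trace ℤ (𝓞 K) $hy)
    rw [map_sub, htr_int, htr_mul] at htr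
    have htr' := congr(($htr : 𝓞 K))
    push_cast at htr'
    linear_combination htr' - hy

end NumberField

/-- `K` is the imaginary quadratic field generated by `s = √Δ`, where `Δ` is squarefree and
`Δ ≢ 1 (mod 4)`, so that `ℤ[s]` is the ring of integers of `K`. -/
structure IsImaginaryQuadratic {K : Type*} [Field K] [NumberField K] (Δ : ℤ) (s : K) : Prop where
  neg : Δ < 0
  squarefree : Squarefree Δ
  mod_four : Δ % 4 ≠ 1
  sq : s ^ 2 = (Δ : K)
  finrank : Module.finrank ℚ K = 2

namespace IsImaginaryQuadratic

variable {K : Type*} [Field K] [NumberField K] {Δ : ℤ} {s : K} (h : IsImaginaryQuadratic Δ s)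

include h

theorem neg_rat : (Δ : ℚ) < 0 := by exact_mod_cast h.neg

theorem sq_eq_smul_one : s ^ 2 = (Δ : ℚ) • (1 : K) := by
  rw [h.sq, ← Algebra.algebraMap_eq_smul_one, map_intCast]

theorem gen_notMem_range : s ∉ Set.range (algebraMap ℚ K) := by
  rintro ⟨q, hq⟩
  have hq2 : q ^ 2 = (Δ : ℚ) := (algebraMap ℚ K).injective (by rw [map_pow, hq, h.sq]; simp)
  nlinarith [h.neg_rat, sq_nonneg q]

theorem trace_gen : Algebra.trace ℚ K s = 0 :=
  (trace_eq_and_norm_eq_of_sq_eq h.finrank h.gen_notMem_range (n := -(Δ : ℚ))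
    (by rw [h.sq_eq_smul_one]; module)).1

theorem trace_coords (u v : ℚ) : Algebra.trace ℚ K (u • 1 + v • s) = 2 * u := by
  have h1 := Algebra.trace_algebraMap (S := K) (1 : ℚ)
  rw [map_one, h.finrank] at h1
  rw [map_add, map_smul, map_smul, h1, h.trace_gen]
  simp [mul_comm]

theorem norm_coords (u v : ℚ) : Algebra.norm ℚ (u • 1 + v • s) = u ^ 2 - Δ * v ^ 2 := by
  have h1 := sq_eq_trace_smul_sub_norm_smul h.finrank (u • 1 + v • s)
  have h2 : (u • 1 + v • s) ^ 2 = (u ^ 2) • (1 : K) + (2 * (u * v)) • s + (v ^ 2) • s ^ 2 := by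
    simp only [Algebra.smul_def, map_mul, map_pow, map_ofNat]; ring
  rw [h.trace_coords, h2, h.sq_eq_smul_one] at h1
  refine smul_left_injective ℚ (one_ne_zero (α := K)) (?_ : _ • _ = _ • _)
  linear_combination (norm := module) h1

theorem exists_coords (x : K) : ∃ u v : ℚ, x = u • 1 + v • s := by
  have hli : LinearIndependent ℚ ![(1 : K), s] := by
    rw [LinearIndependent.pair_iff' one_ne_zero]
    exact fun q hq => h.gen_notMem_range ⟨q, by rw [Algebra.algebraMap_eq_smul_one, hq]⟩
  have hspan := hli.span_eq_top_of_card_eq_finrank (by simp [h.finrank])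
  have hx : x ∈ Submodule.span ℚ {1, s} := by
    rw [← Matrix.range_cons_cons_empty, hspan]; trivial
  obtain ⟨u, v, hx⟩ := Submodule.mem_span_pair.1 hx
  exact ⟨u, v, hx.symm⟩

theorem isIntegral_gen : IsIntegral ℤ s :=
  .of_pow two_pos (h.sq ▸ isIntegral_algebraMap (A := K) (x := Δ))

theorem finite_units : Finite (𝓞 K)ˣ := by
  refine finite_units_of_rank_eq_zero ?_
  have hcomplex : NumberField.IsTotallyComplex K := by
    refine ⟨fun w => NumberField.InfinitePlace.not_isReal_iff_isComplex.1 fun hw => ?_⟩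
    have hsq := congr(NumberField.InfinitePlace.embedding_of_isReal hw $h.sq)
    rw [map_pow, map_intCast] at hsq
    have : (Δ : ℝ) < 0 := by exact_mod_cast h.neg
    nlinarith [sq_nonneg (NumberField.InfinitePlace.embedding_of_isReal hw s)]
  have h2 := NumberField.IsTotallyComplex.finrank K
  have hcard := NumberField.InfinitePlace.card_eq_nrRealPlaces_add_nrComplexPlaces K
  rw [h.finrank] at h2
  rw [NumberField.IsTotallyComplex.nrRealPlaces_eq_zero] at hcard
  rw [NumberField.Units.rank]
  omega

/-- An integral `(s - a) / p` would have norm `(a² - Δ) / p²` and trace `-2a / p`: if `p` is odd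
this makes `p² ∣ Δ`, and if `p = 2` then `Δ ≡ a² (mod 4)`. -/
theorem not_isIntegral_sub_div {p : ℕ} (hp : p.Prime) (a : ℤ) :
    ¬ IsIntegral ℤ ((p : ℚ)⁻¹ • (s - (a : ℚ) • 1)) := by
  intro hi
  have hp0 : (p : ℚ) ≠ 0 := by exact_mod_cast hp.ne_zero
  have hcoords : (p : ℚ)⁻¹ • (s - (a : ℚ) • 1) = (-(a / p) : ℚ) • (1 : K) + (p : ℚ)⁻¹ • s := by
    module
  obtain ⟨t, ht⟩ := IsIntegrallyClosed.isIntegral_iff.1 (Algebra.isIntegral_trace (L := ℚ) hi)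
  obtain ⟨n, hn⟩ := IsIntegrallyClosed.isIntegral_iff.1 (Algebra.isIntegral_norm ℚ hi)
  rw [hcoords, h.trace_coords, eq_intCast] at ht
  rw [hcoords, h.norm_coords, eq_intCast] at hn
  have htrace : t * p = -2 * a := by
    have : (t : ℚ) * p = -2 * a := by rw [ht]; field_simp
    exact_mod_cast this
  have hnorm : n * p ^ 2 = a ^ 2 - Δ := by
    have : (n : ℚ) * p ^ 2 = a ^ 2 - Δ := by rw [hn]; field_simp
    exact_mod_cast this
  have hpi : Prime (p : ℤ) := Nat.prime_iff_prime_int.1 hp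
  have hpa : (p : ℤ) ∣ a → False := by
    rintro ⟨c, rfl⟩
    exact hpi.not_isUnit (h.squarefree _ ⟨c ^ 2 - n, by linarith⟩)
  rcases hp.eq_two_or_odd' with rfl | hodd
  · obtain ⟨c, rfl | rfl⟩ := a.even_or_odd'
    · exact hpa ⟨c, by simp⟩
    · have := h.mod_four
      have : Δ = 4 * (c ^ 2 + c - n) + 1 := by push_cast at hnorm; linarith
      omega
  · refine hpa ((hpi.dvd_or_dvd (a := 2) ⟨-t, by linarith⟩).resolve_left fun h2 => ?_)
    rw [(Nat.prime_dvd_prime_iff_eq hp Nat.prime_two).1 (by exact_mod_cast h2)] at hodd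
    exact absurd hodd (by decide)

section Inert

variable {p : ℕ} (hp : p.Prime) (hinert : (Ideal.span {(p : 𝓞 K)}).IsPrime)

include hinert

theorem isIntegral_inv_smul_of_dvd {u v : ℤ} (hp0 : p ≠ 0) (huv : (p : ℤ) ∣ u ^ 2 - Δ * v ^ 2) :
    IsIntegral ℤ ((p : ℚ)⁻¹ • ((u : ℚ) • (1 : K) + (v : ℚ) • s)) := by
  let r : 𝓞 K := ⟨s, h.isIntegral_gen⟩
  let x : 𝓞 K := u + v * r
  have hx : (x : K) = (u : ℚ) • (1 : K) + (v : ℚ) • s := by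
    simp only [x, map_add, map_mul, map_intCast, Algebra.smul_def, mul_one]
    rfl
  have hnorm : Algebra.norm ℤ x = u ^ 2 - Δ * v ^ 2 := by
    have := Algebra.coe_norm_int x
    rw [hx, h.norm_coords] at this
    exact_mod_cast this
  obtain ⟨y, hy⟩ := dvd_of_dvd_norm h.finrank hinert (hnorm ▸ huv)
  have hxy : (x : K) = (p : ℚ) • (y : K) := by simp [hy, Algebra.smul_def]
  rw [← hx, hxy, inv_smul_smul₀ (by exact_mod_cast hp0)]
  exact y.isIntegral_coe

include hp

theorem not_dvd_two_mul_of_inert : ¬ (p : ℤ) ∣ 2 * Δ := by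
  intro hdvd
  have hpi : Prime (p : ℤ) := Nat.prime_iff_prime_int.1 hp
  have hdvd' : (p : ℤ) ∣ (-Δ) ^ 2 - Δ * 1 ^ 2 := by
    rcases hpi.dvd_or_dvd hdvd with h2 | hΔ
    · refine h2.trans ?_
      obtain ⟨c, hc⟩ := Int.even_mul_pred_self Δ
      exact ⟨c, by linarith⟩
    · exact hΔ.trans ⟨Δ - 1, by ring⟩
  refine h.not_isIntegral_sub_div hp Δ ?_
  convert h.isIntegral_inv_smul_of_dvd hinert hp.ne_zero hdvd' using 2
  push_cast
  module

theorem dvd_and_dvd_of_dvd_sq_sub {u v : ℤ} (huv : (p : ℤ) ∣ u ^ 2 - Δ * v ^ 2) :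
    (p : ℤ) ∣ u ∧ (p : ℤ) ∣ v := by
  have hpi : Prime (p : ℤ) := Nat.prime_iff_prime_int.1 hp
  have hp0 : (p : ℚ) ≠ 0 := by exact_mod_cast hp.ne_zero
  have hi := h.isIntegral_inv_smul_of_dvd hinert hp.ne_zero huv
  have hcoords : (p : ℚ)⁻¹ • ((u : ℚ) • (1 : K) + (v : ℚ) • s) =
      ((p : ℚ)⁻¹ * u) • (1 : K) + ((p : ℚ)⁻¹ * v) • s := by module
  have hcoords_mul : (p : ℚ)⁻¹ • ((u : ℚ) • (1 : K) + (v : ℚ) • s) * s =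
      ((p : ℚ)⁻¹ * v * Δ) • (1 : K) + ((p : ℚ)⁻¹ * u) • s := by
    rw [hcoords, add_mul, smul_mul_assoc, smul_mul_assoc, one_mul, ← pow_two, h.sq_eq_smul_one]
    module
  have hdvd {q : ℤ} {x : K} (hx : IsIntegral ℤ x)
      (htr : Algebra.trace ℚ K x = 2 * ((p : ℚ)⁻¹ * q)) : (p : ℤ) ∣ 2 * q := by
    obtain ⟨t, ht⟩ := IsIntegrallyClosed.isIntegral_iff.1 (Algebra.isIntegral_trace (L := ℚ) hx)
    refine ⟨t, ?_⟩
    rw [htr, eq_intCast] at ht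
    have : (2 * q : ℚ) = p * t := by rw [ht]; field_simp
    exact_mod_cast this
  have h2Δ := h.not_dvd_two_mul_of_inert hp hinert
  have hu : (p : ℤ) ∣ 2 * u := hdvd hi (by rw [hcoords, h.trace_coords])
  have hv : (p : ℤ) ∣ 2 * (v * Δ) := hdvd (hi.mul h.isIntegral_gen) (by
    rw [hcoords_mul, h.trace_coords]; push_cast; ring)
  refine ⟨(hpi.dvd_or_dvd hu).resolve_left fun h2 => h2Δ (h2.mul_right Δ), ?_⟩
  exact (hpi.dvd_or_dvd (by convert hv using 1; ring : (p : ℤ) ∣ 2 * Δ * v)).resolve_left h2Δ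

end Inert

end IsImaginaryQuadratic

section CoprimeMultiples

theorem absNorm_coprime_of_isCoprime {R : Type*} [CommRing R] [IsDedekindDomain R]
    [Module.Free ℤ R] [Module.Finite ℤ R] {I : Ideal R} {n : ℕ}
    (h : IsCoprime I (Ideal.span {(n : R)})) : (Ideal.absNorm I).Coprime n := by
  refine Nat.Coprime.symm (Nat.coprime_of_dvd fun p hp hpn hpI => ?_)
  obtain ⟨P, hP, hpP, hIP⟩ := Ideal.exists_isMaximal_dvd_of_dvd_absNorm' hp I hpI
  have hpP' : (p : R) ∈ P := by
    simpa using (hpP ▸ Ideal.mem_span_singleton_self (p : ℤ) : (p : ℤ) ∈ P.under ℤ)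
  have hnP : Ideal.span {(n : R)} ≤ P := by
    rw [Ideal.span_singleton_le_iff_mem]
    exact Ideal.mem_of_dvd P (Nat.cast_dvd_cast hpn) hpP'
  exact hP.ne_top (top_le_iff.1 ((Ideal.isCoprime_iff_sup_eq.1 h).ge.trans
    (sup_le (Ideal.dvd_iff_le.1 hIP) hnP)))

theorem exists_mul_eq_span_and_isCoprime {R : Type*} [CommRing R] [IsDedekindDomain R]
    {I J : Ideal R} (hI : I ≠ 0) (hJ : J ≠ 0) :
    ∃ (a : R) (C : Ideal R), I * C = Ideal.span {a} ∧ IsCoprime C J := by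
  obtain ⟨a, ha⟩ := IsDedekindDomain.exists_sup_span_eq (Ideal.mul_le_left : I * J ≤ I)
    (mul_ne_zero hI hJ)
  obtain ⟨C, hC⟩ := Ideal.dvd_iff_le.2 (ha ▸ le_sup_right : Ideal.span {a} ≤ I)
  refine ⟨a, C, hC.symm, ?_⟩
  rw [hC, ← Ideal.mul_sup] at ha
  rw [Ideal.isCoprime_iff_sup_eq, sup_comm]
  exact mul_left_cancel₀ hI (ha.trans (Ideal.mul_top I).symm)

variable {K : Type*} [Field K] [NumberField K]

theorem absNorm_pos {I : FractionalIdeal (𝓞 K)⁰ K} (hI : I ≠ 0) :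
    0 < FractionalIdeal.absNorm I :=
  (FractionalIdeal.absNorm_nonneg I).lt_of_ne' (mt FractionalIdeal.absNorm_eq_zero_iff.1 hI)

theorem exists_mul_eq_spanSingleton_and_isCoprime {I : FractionalIdeal (𝓞 K)⁰ K} (hI : I ≠ 0)
    {J : Ideal (𝓞 K)} (hJ : J ≠ 0) :
    ∃ (x : K) (C : Ideal (𝓞 K)),
      I * C = FractionalIdeal.spanSingleton (𝓞 K)⁰ x ∧ IsCoprime C J := by
  obtain ⟨d, I', -, rfl⟩ := FractionalIdeal.exists_eq_spanSingleton_mul I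
  have hI' : I' ≠ 0 := by rintro rfl; simp at hI
  obtain ⟨a, C, hC, hCJ⟩ := exists_mul_eq_span_and_isCoprime hI' hJ
  refine ⟨(algebraMap (𝓞 K) K d)⁻¹ * a, C, ?_, hCJ⟩
  rw [mul_assoc, ← FractionalIdeal.coeIdeal_mul, hC, FractionalIdeal.coeIdeal_span_singleton,
    FractionalIdeal.spanSingleton_mul_spanSingleton]

theorem exists_mem_and_abs_norm_eq {I : FractionalIdeal (𝓞 K)⁰ K} (hI : I ≠ 0) {n : ℕ}
    (hn : n ≠ 0) :
    ∃ x ∈ I, x ≠ 0 ∧ ∃ k : ℕ, k.Coprime n ∧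
      |Algebra.norm ℚ x| = k * FractionalIdeal.absNorm I ∧
      ∀ z ∈ I, ∃ a : 𝓞 K, (k : K) * z = a * x := by
  -- Coprimality to `2 n` instead of `n` excludes `C = 0` also when `n = 1`.
  obtain ⟨x, C, hx, hC⟩ := exists_mul_eq_spanSingleton_and_isCoprime hI
    (J := Ideal.span {((2 * n : ℕ) : 𝓞 K)}) (by simpa [Ideal.zero_eq_bot] using hn)
  have hcop := absNorm_coprime_of_isCoprime hC
  have hnorm : |Algebra.norm ℚ x| = Ideal.absNorm C * FractionalIdeal.absNorm I := by
    rw [← FractionalIdeal.absNorm_span_singleton (R := 𝓞 K), ← hx, map_mul,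
      FractionalIdeal.coeIdeal_absNorm, mul_comm]
  refine ⟨x, ?_, ?_, Ideal.absNorm C, hcop.coprime_mul_left_right, hnorm, fun z hz => ?_⟩
  · rw [← FractionalIdeal.spanSingleton_le_iff_mem, ← hx]
    exact (mul_le_mul_right FractionalIdeal.coeIdeal_le_one I).trans_eq (mul_one I)
  · rintro rfl
    have hC0 : Ideal.absNorm C = 0 := by
      exact_mod_cast show (Ideal.absNorm C : ℚ) = 0 by
        simpa [(absNorm_pos hI).ne', eq_comm] using hnorm
    rw [hC0, Nat.coprime_zero_left] at hcop
    lia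
  · have hkz : z * ((Ideal.absNorm C : 𝓞 K) : K) ∈ I * C := FractionalIdeal.mul_mem_mul hz
      (FractionalIdeal.mem_coeIdeal_of_mem _ (Ideal.absNorm_mem C))
    rw [hx, FractionalIdeal.mem_spanSingleton] at hkz
    obtain ⟨a, ha⟩ := hkz
    exact ⟨a, by rw [← Algebra.smul_def, ha, mul_comm]; simp⟩

end CoprimeMultiples

section ConjEmbedding

variable {K B : Type*} [Field K] [Ring B] [Algebra ℚ B]

theorem mem_of_coprime_smul_mem {O : Subring B} {x : B} {k l : ℕ} (hkl : k.Coprime l)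
    (hk : (k : ℚ) • x ∈ O) (hl : (l : ℚ) • x ∈ O) : x ∈ O := by
  have h : (1 : ℚ) = k * Nat.gcdA k l + l * Nat.gcdB k l := by
    exact_mod_cast hkl.gcd_eq_one ▸ Nat.gcd_eq_gcd_ab k l
  rw [← one_smul ℚ x, h, add_smul, mul_comm, mul_smul, mul_comm, mul_smul]
  exact add_mem (intCast_smul_mem _ hk) (intCast_smul_mem _ hl)

/-- The conjugate embedding `x ↦ b⁻¹ φ(x) b`. -/
def conjEmbedding [Algebra ℚ K] (φ : K →ₐ[ℚ] B) (b : Bˣ) : K →ₐ[ℚ] B where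
  toFun x := ↑b⁻¹ * φ x * b
  map_one' := by simp
  map_mul' x y := by simp [mul_assoc]
  map_zero' := by simp
  map_add' x y := by simp [mul_add, add_mul]
  commutes' q := by
    rw [φ.commutes, mul_assoc, Algebra.commutes, ← mul_assoc, Units.inv_mul, one_mul]

theorem conjEmbedding_apply [Algebra ℚ K] (φ : K →ₐ[ℚ] B) (b : Bˣ) (x : K) :
    conjEmbedding φ b x = ↑b⁻¹ * φ x * b := rfl

theorem conjEmbedding_eq_of_eq_map_mul [Algebra ℚ K] (φ : K →ₐ[ℚ] B) {b c : Bˣ} {x : K}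
    (hc : (c : B) = φ x * b) : conjEmbedding φ c = conjEmbedding φ b := by
  ext y
  rw [conjEmbedding_apply, conjEmbedding_apply, mul_assoc, mul_assoc, Units.inv_mul_eq_iff_eq_mul,
    hc, mul_assoc, Units.mul_inv_cancel_left, ← mul_assoc, ← mul_assoc, ← map_mul, ← map_mul,
    mul_comm]

variable [NumberField K] [Nontrivial B] {O : Subring B} (hO : IsOrder O)
  (φ : K →ₐ[ℚ] B) (hφ : ∀ a : 𝓞 K, φ a ∈ O) (b : Bˣ)

/-- The fractional ideal of all `x` with `φ(x) b ∈ O`. -/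
def leftIdeal : FractionalIdeal (𝓞 K)⁰ K where
  val :=
    { carrier := {x | φ x * b ∈ O}
      add_mem' {x y} hx hy := by
        change φ (x + y) * b ∈ O
        rw [map_add, add_mul]
        exact add_mem hx hy
      zero_mem' := by simp
      smul_mem' a x hx := by
        change φ (a • x) * b ∈ O
        rw [Algebra.smul_def, map_mul, mul_assoc]
        exact mul_mem (hφ a) hx }
  property := by
    obtain ⟨M, hM, hMb⟩ := hO.exists_natCast_smul_mem (↑b⁻¹ : B)
    refine ⟨M, mem_nonZeroDivisors_of_ne_zero (by exact_mod_cast hM.ne'),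
      fun x (hx : φ x * b ∈ O) => ?_⟩
    have hMx : φ ((M : ℚ) • x) ∈ O := by
      have := mul_mem hx hMb
      rwa [mul_smul_comm, mul_assoc, Units.mul_inv, mul_one, ← map_smul] at this
    have hint : IsIntegral ℤ ((M : ℚ) • x) :=
      (isIntegral_algHom_iff (φ.restrictScalars ℤ) φ.toRingHom.injective).1 (hO.isIntegral hMx)
    exact ⟨⟨_, hint⟩, by simp [Algebra.smul_def]⟩

@[simp] theorem mem_leftIdeal {x : K} : x ∈ leftIdeal hO φ hφ b ↔ φ x * b ∈ O := Iff.rfl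

theorem leftIdeal_ne_zero : leftIdeal hO φ hφ b ≠ 0 := by
  obtain ⟨M, hM, hMb⟩ := hO.exists_natCast_smul_mem (b : B)
  intro h0
  have hmem : (M : ℚ) • (1 : K) ∈ leftIdeal hO φ hφ b := by
    rwa [mem_leftIdeal, map_smul, map_one, smul_mul_assoc, one_mul]
  rw [h0, FractionalIdeal.mem_zero_iff, smul_eq_zero] at hmem
  simp [hM.ne'] at hmem

end ConjEmbedding

section Index

variable {K : Type*} [Field K] [NumberField K] {α β : ℚ} {O : Subring ℍ[ℚ,α,β]} (hO : IsOrder O)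
  (φ : K →ₐ[ℚ] ℍ[ℚ,α,β]) (hφ : ∀ a : 𝓞 K, φ a ∈ O) (b : (ℍ[ℚ,α,β])ˣ)

theorem star_mul_map_mul_eq (x : K) :
    star (b : ℍ[ℚ,α,β]) * φ x * b = nrd (b : ℍ[ℚ,α,β]) • conjEmbedding φ b x := by
  rw [conjEmbedding_apply, coe_inv_eq, smul_mul_assoc, smul_mul_assoc,
    smul_inv_smul₀ (nrd_unit_ne_zero b)]

/-- The number `N(J) |Nrd(b)|`, where `J` is the fractional ideal of all `x` with `φ(x) b ∈ O`. It
depends only on the embedding `x ↦ b⁻¹ φ(x) b`. -/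
noncomputable def leftIdealIndex : ℚ :=
  FractionalIdeal.absNorm (leftIdeal hO φ hφ b) * |nrd (b : ℍ[ℚ,α,β])|

theorem leftIdealIndex_pos : 0 < leftIdealIndex hO φ hφ b :=
  mul_pos (absNorm_pos (leftIdeal_ne_zero hO φ hφ b)) (abs_pos.2 (nrd_unit_ne_zero b))

theorem exists_coprime_representative (hK : Module.finrank ℚ K = 2) {n : ℕ} (hn : n ≠ 0) :
    ∃ (c : (ℍ[ℚ,α,β])ˣ) (k : ℕ), k.Coprime n ∧ (c : ℍ[ℚ,α,β]) ∈ O ∧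
      conjEmbedding φ c = conjEmbedding φ b ∧
      |nrd (c : ℍ[ℚ,α,β])| = k * leftIdealIndex hO φ hφ b ∧
      ∀ z : K, φ z * c ∈ O → IsIntegral ℤ ((k : ℚ) • z) := by
  obtain ⟨x, hx, hx0, k, hk, hnorm, hdvd⟩ :=
    exists_mem_and_abs_norm_eq (leftIdeal_ne_zero hO φ hφ b) hn
  let c := (Units.mk0 x hx0).map (φ : K →* ℍ[ℚ,α,β]) * b
  have hc : (c : ℍ[ℚ,α,β]) = φ x * b := rfl
  refine ⟨c, k, hk, hc ▸ hx, conjEmbedding_eq_of_eq_map_mul φ hc, ?_, fun z hz => ?_⟩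
  · rw [hc, nrd_mul, (trd_map_and_nrd_map hK φ x).2, abs_mul, hnorm, leftIdealIndex, mul_assoc]
  · obtain ⟨a, ha⟩ := hdvd (z * x) (by rwa [mem_leftIdeal, map_mul, mul_assoc, ← hc])
    have hkz : (k : ℚ) • z = a := mul_right_cancel₀ hx0 (by
      rw [← ha, Algebra.smul_def, map_natCast, mul_assoc])
    rw [hkz]
    exact a.isIntegral_coe

theorem leftIdealIndex_smul_mem (hK : Module.finrank ℚ K = 2) (y : 𝓞 K) :
    leftIdealIndex hO φ hφ b • conjEmbedding φ b y ∈ O := by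
  have hmem {n : ℕ} (hn : n ≠ 0) : ∃ k : ℕ, k.Coprime n ∧
      (k : ℚ) • leftIdealIndex hO φ hφ b • conjEmbedding φ b y ∈ O := by
    obtain ⟨c, k, hk, hcO, hc, hnrd, -⟩ := exists_coprime_representative hO φ hφ b hK hn
    refine ⟨k, hk, ?_⟩
    have := mul_mem (mul_mem (hO.star_mem hcO) (hφ y)) hcO
    rw [star_mul_map_mul_eq, hc] at this
    rw [smul_smul, ← hnrd]
    rcases abs_choice (nrd (c : ℍ[ℚ,α,β])) with h | h <;> rw [h]
    · exact this
    · rw [neg_smul]; exact neg_mem this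
  obtain ⟨k, hk2, hk⟩ := hmem two_ne_zero
  have hk0 : k ≠ 0 := by rintro rfl; simp at hk2
  obtain ⟨l, hlk, hl⟩ := hmem hk0
  exact mem_of_coprime_smul_mem hlk hl hk

theorem exists_natCast_eq_leftIdealIndex (hK : Module.finrank ℚ K = 2) :
    ∃ N : ℕ, 0 < N ∧ leftIdealIndex hO φ hφ b = N := by
  have hpos := leftIdealIndex_pos hO φ hφ b
  have hmem : leftIdealIndex hO φ hφ b • (1 : ℍ[ℚ,α,β]) ∈ O := by
    simpa only [map_one] using leftIdealIndex_smul_mem hO φ hφ b hK 1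
  obtain ⟨n, hn⟩ := hO.exists_int_of_smul_one_mem hmem
  rw [hn] at hpos ⊢
  lift n to ℕ using by exact_mod_cast hpos.le
  exact ⟨n, by exact_mod_cast hpos, by simp⟩

end Index

section LocalMaximality

theorem exists_intCast_eq_of_padic_norm_le_one {p : ℕ} [hp : Fact p.Prime] {q : ℚ} {k : ℕ} {n : ℤ}
    (hq : (p : ℚ) ^ k * q = n) (h : ‖(q : ℚ_[p])‖ ≤ 1) : ∃ z : ℤ, q = z := by
  have hn : ‖(n : ℚ_[p])‖ ≤ (p : ℝ) ^ (-k : ℤ) := by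
    have hq' : (n : ℚ_[p]) = (p : ℚ_[p]) ^ k * (q : ℚ_[p]) := by
      exact_mod_cast congr(($hq.symm : ℚ_[p]))
    rw [hq', norm_mul, norm_pow, Padic.norm_p, zpow_neg, zpow_natCast, inv_pow]
    exact mul_le_of_le_one_right (by positivity) h
  obtain ⟨z, rfl⟩ := (Padic.norm_int_le_pow_iff_dvd n k).1 hn
  exact ⟨z, mul_left_cancel₀ (pow_ne_zero k (Nat.cast_ne_zero.2 hp.out.ne_zero)) (by simp [hq])⟩

/-- The ring `O[1/p]`. -/
def awayFrom {B : Type*} [Ring B] [Algebra ℚ B] (O : Subring B) (p : ℕ) : Subring B where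
  carrier := {x | ∃ k : ℕ, ((p ^ k : ℕ) : ℚ) • x ∈ O}
  mul_mem' := by
    rintro x y ⟨k, hk⟩ ⟨l, hl⟩
    refine ⟨k + l, ?_⟩
    rw [pow_add, Nat.cast_mul, ← smul_mul_smul_comm]
    exact mul_mem hk hl
  one_mem' := ⟨0, by simp⟩
  add_mem' := by
    rintro x y ⟨k, hk⟩ ⟨l, hl⟩
    refine ⟨k + l, ?_⟩
    have h : ((p ^ (k + l) : ℕ) : ℚ) • (x + y) =
        ((p ^ l : ℕ) : ℚ) • ((p ^ k : ℕ) : ℚ) • x + ((p ^ k : ℕ) : ℚ) • ((p ^ l : ℕ) : ℚ) • y := by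
      push_cast [pow_add]; module
    exact h ▸ add_mem (natCast_smul_mem _ hk) (natCast_smul_mem _ hl)
  zero_mem' := ⟨0, by simp⟩
  neg_mem' := by
    rintro x ⟨k, hk⟩
    exact ⟨k, by rw [smul_neg]; exact neg_mem hk⟩

variable {α β : ℚ} {O : Subring ℍ[ℚ,α,β]}

theorem IsMaximalOrder.mem_of_pow_smul_mem (hα : α ≠ 0) (hβ : β ≠ 0) (hO : IsMaximalOrder O)
    {p : ℕ} [Fact p.Prime] {R : Subring ℍ[ℚ,α,β]} (hR : ∀ x ∈ R, ‖(trd x : ℚ_[p])‖ ≤ 1)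
    (hle : O ≤ R) {x : ℍ[ℚ,α,β]} (hx : x ∈ R) {k : ℕ} (hk : ((p ^ k : ℕ) : ℚ) • x ∈ O) :
    x ∈ O := by
  rw [← hO.eq_of_trd_integral hα hβ (O' := awayFrom O p ⊓ R)]
  · exact ⟨⟨k, hk⟩, hx⟩
  · exact le_inf (fun y hy => ⟨0, by simpa using hy⟩) hle
  · rintro y ⟨⟨l, hl⟩, hy⟩
    obtain ⟨n, hn⟩ := hO.prop.exists_trd_eq hl
    rw [trd_smul, Nat.cast_pow] at hn
    exact exists_intCast_eq_of_padic_norm_le_one hn (hR y hy)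

end LocalMaximality

section Representations

theorem map_eq_re_smul_of_map_mul_comm {α β : ℚ} (hα : α ≠ 0) (hβ : β ≠ 0) {V : Type*}
    [AddCommGroup V] [Module ℚ V] (T : ℍ[ℚ,α,β] →ₗ[ℚ] V) (hT : ∀ x y, T (x * y) = T (y * x))
    (x : ℍ[ℚ,α,β]) : T x = x.re • T 1 := by
  -- A pure quaternion is a combination of the commutators of `i`, `j` and `k`.
  let i : ℍ[ℚ,α,β] := ⟨0, 1, 0, 0⟩
  let j : ℍ[ℚ,α,β] := ⟨0, 0, 1, 0⟩
  let k : ℍ[ℚ,α,β] := ⟨0, 0, 0, 1⟩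
  have hx : x = x.re • 1 + (-x.imI / (2 * β)) • (j * k - k * j) +
      (x.imJ / (2 * α)) • (i * k - k * i) + (x.imK / 2) • (i * j - j * i) := by
    ext <;> simp [i, j, k] <;> field_simp <;> ring
  conv_lhs => rw [hx]
  simp [hT i, hT j k]

theorem trace_map_eq_trd {α β : ℚ} (hα : α ≠ 0) (hβ : β ≠ 0) {F : Type*} [Field F] [Algebra ℚ F]
    (f : ℍ[ℚ,α,β] →ₐ[ℚ] Matrix (Fin 2) (Fin 2) F) (x : ℍ[ℚ,α,β]) :
    (f x).trace = algebraMap ℚ F (trd x) := by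
  have h := map_eq_re_smul_of_map_mul_comm hα hβ
    ((Matrix.traceLinearMap (Fin 2) ℚ F).comp f.toLinearMap)
    (fun y z => by simp [Matrix.trace_mul_comm (f y)]) x
  rw [trd_eq, map_mul, map_ofNat, mul_comm]
  simpa [Algebra.smul_def] using h

variable {A K : Type*} [CommRing A] [Field K] [Algebra A K] {n : Type*} [Fintype n] [DecidableEq n]

theorem exists_isLattice_mulVec_mem {S : Subring (Matrix n n K)} (hS : S.toAddSubgroup.FG) :
    ∃ L : Submodule A (n → K), Submodule.IsLattice K L ∧ ∀ M ∈ S, ∀ v ∈ L, M.mulVec v ∈ L := by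
  obtain ⟨T, hT⟩ := hS
  let L : Submodule A (n → K) :=
    Submodule.span A (Set.image2 (fun (M : Matrix n n K) i => M.mulVec (Pi.single i 1)) T Set.univ)
  have hsingle : ∀ M ∈ S, ∀ i, M.mulVec (Pi.single i 1) ∈ L := by
    intro M hM i
    replace hM : M ∈ AddSubgroup.closure (T : Set (Matrix n n K)) := hT ▸ hM
    induction hM using AddSubgroup.closure_induction with
    | mem M hM => exact Submodule.subset_span ⟨M, hM, i, trivial, rfl⟩
    | zero => rw [Matrix.zero_mulVec]; exact zero_mem _
    | add M N _ _ hM hN => rw [Matrix.add_mulVec]; exact add_mem hM hN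
    | neg M _ hM => rw [Matrix.neg_mulVec]; exact neg_mem hM
  refine ⟨L, ⟨Submodule.fg_span (T.finite_toSet.image2 _ Set.finite_univ), top_le_iff.1 ?_⟩,
    fun M hM v hv => ?_⟩
  · rw [← (Pi.basisFun K n).span_eq]
    refine Submodule.span_mono ?_
    rintro _ ⟨i, rfl⟩
    have h := hsingle 1 S.one_mem i
    rwa [Matrix.one_mulVec, ← Pi.basisFun_apply] at h
  · induction hv using Submodule.span_induction with
    | mem v hv =>
      obtain ⟨N, hN, i, -, rfl⟩ := hv
      rw [Matrix.mulVec_mulVec]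
      exact hsingle _ (mul_mem hM (hT.le (AddSubgroup.subset_closure hN))) i
    | zero => rw [Matrix.mulVec_zero]; exact zero_mem _
    | add u v _ _ hu hv => rw [Matrix.mulVec_add]; exact add_mem hu hv
    | smul c v _ hv => rw [Matrix.mulVec_smul]; exact Submodule.smul_mem _ _ hv

variable [IsDomain A] [IsPrincipalIdealRing A] [IsFractionRing A K]

theorem exists_algEquiv_mem_range {S : Subring (Matrix n n K)} (hS : S.toAddSubgroup.FG) :
    ∃ E : Matrix n n K ≃ₐ[K] Matrix n n K, ∀ M ∈ S, E M ∈ (algebraMap A K).mapMatrix.range := by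
  obtain ⟨L, hL, hSL⟩ := exists_isLattice_mulVec_mem (A := A) hS
  have hfr : Module.finrank A L = Fintype.card n := by
    rw [Submodule.IsLattice.finrank_of_pi]
  let b : Module.Basis n A L :=
    (Module.finBasisOfFinrankEq _ _ hfr).reindex (Fintype.equivFin n).symm
  let b' : Module.Basis n K (n → K) := b.extendOfIsLattice K
  refine ⟨Matrix.toLinAlgEquiv'.trans (LinearMap.toMatrixAlgEquiv b'), fun M hM => ?_⟩
  let v (j : n) : L := ⟨M.mulVec (b j : n → K), hSL M hM _ (b j).2⟩
  refine ⟨Matrix.of fun i j => b.repr (v j) i, Matrix.ext fun i j => ?_⟩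
  have hv : M.mulVec (b' j) = ∑ l, algebraMap A K (b.repr (v j) l) • b' l := by
    have h := congr(($(b.sum_repr (v j)) : n → K))
    rw [Submodule.coe_sum] at h
    simpa only [b', v, Module.Basis.extendOfIsLattice_apply, algebraMap_smul,
      Submodule.coe_smul] using h.symm
  change _ = LinearMap.toMatrixAlgEquiv b' (Matrix.toLinAlgEquiv' M) i j
  rw [LinearMap.toMatrixAlgEquiv_apply, Matrix.toLinAlgEquiv'_apply, hv,
    Module.Basis.repr_sum_self]
  rfl

theorem IsOrder.exists_integral_rep {B : Type*} [Ring B] [Algebra ℚ B] [Algebra ℚ K]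
    {O : Subring B} (hO : IsOrder O) (f : B →ₐ[ℚ] Matrix n n K) :
    ∃ (g : B →ₐ[ℚ] Matrix n n K) (G : O →+* Matrix n n A),
      ∀ x : O, (algebraMap A K).mapMatrix (G x) = g x := by
  classical
  have hS : (O.map (f : B →+* Matrix n n K)).toAddSubgroup.FG := by
    obtain ⟨T, hT⟩ := hO.1
    refine ⟨T.image f, ?_⟩
    rw [Finset.coe_image]
    exact (AddMonoidHom.map_closure (f : B →+ Matrix n n K) T).symm.trans
      (congrArg (AddSubgroup.map (f : B →+ Matrix n n K)) hT)
  obtain ⟨E, hE⟩ := exists_algEquiv_mem_range (A := A) hS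
  let g := ((E : Matrix n n K →ₐ[K] Matrix n n K).restrictScalars ℚ).comp f
  have hinj : Function.Injective ((algebraMap A K).mapMatrix : Matrix n n A →+* Matrix n n K) :=
    Matrix.map_injective (FaithfulSMul.algebraMap_injective A K)
  let e := RingEquiv.ofLeftInverse (Function.leftInverse_invFun hinj)
  let gO := ((g : B →+* Matrix n n K).comp O.subtype).codRestrict
    ((algebraMap A K).mapMatrix : Matrix n n A →+* Matrix n n K).range
    fun x => hE _ ⟨x, x.2, rfl⟩
  exact ⟨g, (e.symm : _ →+* Matrix n n A).comp gO, fun x =>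
    congr(($(e.apply_symm_apply (gO x)) : Matrix n n K))⟩

end Representations

section SplitPrimes

variable {α β : ℚ} {O : Subring ℍ[ℚ,α,β]} {p : ℕ} [hp : Fact p.Prime]

theorem IsMaximalOrder.inv_smul_mem_of_residue_eq_zero (hα : α ≠ 0) (hβ : β ≠ 0)
    (hO : IsMaximalOrder O) {g : ℍ[ℚ,α,β] →ₐ[ℚ] Matrix (Fin 2) (Fin 2) ℚ_[p]}
    {G : O →+* Matrix (Fin 2) (Fin 2) ℤ_[p]}
    (hG : ∀ x : O, (algebraMap ℤ_[p] ℚ_[p]).mapMatrix (G x) = g x) {x : O}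
    (hx : PadicInt.toZMod.mapMatrix (G x) = 0) : (p : ℚ)⁻¹ • (x : ℍ[ℚ,α,β]) ∈ O := by
  let R : Subring ℍ[ℚ,α,β] := ((algebraMap ℤ_[p] ℚ_[p]).mapMatrix.range).comap
    (g : ℍ[ℚ,α,β] →+* Matrix (Fin 2) (Fin 2) ℚ_[p])
  have hR : ∀ y ∈ R, ‖(trd y : ℚ_[p])‖ ≤ 1 := by
    rintro y ⟨M, hM⟩
    have h : (M.trace : ℚ_[p]) = trd y := by
      rw [← eq_ratCast (algebraMap ℚ ℚ_[p]), ← trace_map_eq_trd hα hβ g]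
      exact (AddMonoidHom.map_trace (algebraMap ℤ_[p] ℚ_[p]) M).trans congr(Matrix.trace $hM)
    exact h ▸ M.trace.norm_le_one
  have hdvd (i j : Fin 2) : (p : ℤ_[p]) ∣ G x i j := by
    rw [← Ideal.mem_span_singleton, ← PadicInt.maximalIdeal_eq_span_p, ← PadicInt.ker_toZMod]
    exact congr($hx i j)
  choose C hC using hdvd
  have hp0 : (p : ℚ) ≠ 0 := Nat.cast_ne_zero.2 hp.out.ne_zero
  refine hO.mem_of_pow_smul_mem hα hβ hR (fun y hy => ⟨G ⟨y, hy⟩, hG _⟩) ⟨Matrix.of C, ?_⟩ (k := 1)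
    (by rw [pow_one, smul_inv_smul₀ hp0]; exact x.2)
  have hGx : G x = p • Matrix.of C := Matrix.ext fun i j => by simp [hC]
  change _ = g ((p : ℚ)⁻¹ • (x : ℍ[ℚ,α,β]))
  rw [map_smul, eq_inv_smul_iff₀ hp0, ← hG, hGx, map_nsmul, Nat.cast_smul_eq_nsmul]

theorem adjugate_eq_trace_smul_sub {R : Type*} [CommRing R] (M : Matrix (Fin 2) (Fin 2) R) :
    M.adjugate = M.trace • 1 - M := by
  rw [Matrix.adjugate_fin_two, Matrix.trace_fin_two]
  ext i j
  fin_cases i <;> fin_cases j <;> simp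

theorem map_star_eq_adjugate (hα : α ≠ 0) (hβ : β ≠ 0) {A F : Type*} [CommRing A] [Field F]
    [Algebra A F] [FaithfulSMul A F] [Algebra ℚ F]
    {g : ℍ[ℚ,α,β] →ₐ[ℚ] Matrix (Fin 2) (Fin 2) F} {G : O →+* Matrix (Fin 2) (Fin 2) A}
    (hG : ∀ x : O, (algebraMap A F).mapMatrix (G x) = g x) {x y : O}
    (hxy : (y : ℍ[ℚ,α,β]) = star (x : ℍ[ℚ,α,β])) : G y = (G x).adjugate := by
  refine Matrix.map_injective (FaithfulSMul.algebraMap_injective A F) ?_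
  change (algebraMap A F).mapMatrix (G y) = (algebraMap A F).mapMatrix (G x).adjugate
  have htr : g y = (g x).trace • 1 - g x := by
    rw [hxy, star_eq_trd_sub, map_sub, map_smul, map_one, trace_map_eq_trd hα hβ, algebraMap_smul]
  rw [RingHom.map_adjugate, hG, hG, htr, adjugate_eq_trace_smul_sub]

theorem IsMaximalOrder.exists_residue (hα : α ≠ 0) (hβ : β ≠ 0) (hO : IsMaximalOrder O)
    (hsplit : ¬ IsRamifiedAt ℍ[ℚ,α,β] p) :
    ∃ r : O →+* Matrix (Fin 2) (Fin 2) (ZMod p),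
      (∀ x : O, r x = 0 ↔ (p : ℚ)⁻¹ • (x : ℍ[ℚ,α,β]) ∈ O) ∧
      ∀ x y : O, (y : ℍ[ℚ,α,β]) = star (x : ℍ[ℚ,α,β]) → r y = (r x).adjugate := by
  obtain ⟨e⟩ := not_not.1 hsplit
  obtain ⟨g, G, hG⟩ := hO.prop.exists_integral_rep (A := ℤ_[p])
    ((e.toAlgHom.restrictScalars ℚ).comp Algebra.TensorProduct.includeRight)
  refine ⟨PadicInt.toZMod.mapMatrix.comp G, fun x =>
    ⟨hO.inv_smul_mem_of_residue_eq_zero hα hβ hG, fun h => ?_⟩, fun x y hxy => ?_⟩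
  · have hx : x = p * ⟨_, h⟩ := Subtype.ext <| by
      simp [← Nat.cast_smul_eq_nsmul ℚ, ← nsmul_eq_mul, smul_smul, hp.out.ne_zero]
    rw [hx, map_mul, map_natCast, ← Matrix.diagonal_natCast]
    simp
  · rw [RingHom.comp_apply, map_star_eq_adjugate hα hβ hG hxy, RingHom.map_adjugate]
    rfl

theorem mul_mul_eq_trace_smul_of_det_eq_zero {R : Type*} [CommRing R]
    {b : Matrix (Fin 2) (Fin 2) R} (hdet : b.det = 0) (y : Matrix (Fin 2) (Fin 2) R) :
    b * y * b = (b * y).trace • b := by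
  have h : (b * y).adjugate * b = 0 := by
    rw [Matrix.adjugate_mul_distrib, mul_assoc, Matrix.adjugate_mul, hdet, zero_smul, mul_zero]
  rw [adjugate_eq_trace_smul_sub, sub_mul, smul_mul_assoc, one_mul, sub_eq_zero] at h
  exact h.symm

/-- The kernel of `adj(b)` is the line spanned by the columns of `b`, so `m` preserves this line. -/
theorem exists_mul_eq_smul_of_adjugate_mul_eq_zero {F : Type*} [Field F]
    {b m : Matrix (Fin 2) (Fin 2) F} (hdet : b.det = 0) (h : b.adjugate * (m * b) = 0) :
    ∃ a : F, m * b = a • b := by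
  by_cases hb : b = 0
  · exact ⟨0, by rw [hb, mul_zero, smul_zero]⟩
  obtain ⟨i, j, hij⟩ : ∃ i j, b i j ≠ 0 := by
    by_contra! h0
    exact hb (Matrix.ext h0)
  let x : Matrix (Fin 2) (Fin 2) F := Matrix.single j i (b i j)⁻¹
  have htr : (b * x).trace = 1 := by
    simp [x, Matrix.trace_mul_single, hij]
  have hfix : m * b = b * x * (m * b) := by
    have h0 : (b * x).adjugate * (m * b) = 0 := by
      rw [Matrix.adjugate_mul_distrib, mul_assoc, h, mul_zero]
    rwa [adjugate_eq_trace_smul_sub, htr, one_smul, sub_mul, one_mul, sub_eq_zero] at h0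
  refine ⟨(b * (x * m)).trace, ?_⟩
  rw [← mul_mul_eq_trace_smul_of_det_eq_zero hdet, hfix]
  simp only [mul_assoc]

theorem IsMaximalOrder.exists_inv_smul_sub_mul_mem (hα : α ≠ 0) (hβ : β ≠ 0)
    (hO : IsMaximalOrder O) (hsplit : ¬ IsRamifiedAt ℍ[ℚ,α,β] p) {y b : ℍ[ℚ,α,β]} (hy : y ∈ O)
    (hb : b ∈ O) (hnrd : (p : ℚ)⁻¹ • (star b * b) ∈ O) (h : (p : ℚ)⁻¹ • (star b * y * b) ∈ O) :
    ∃ a : ℤ, (p : ℚ)⁻¹ • ((y - (a : ℚ) • 1) * b) ∈ O := by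
  obtain ⟨r, hr, hstar⟩ := hO.exists_residue hα hβ hsplit
  let b' : O := ⟨b, hb⟩
  let sb : O := ⟨star b, hO.prop.star_mem hb⟩
  let y' : O := ⟨y, hy⟩
  have hsb : r sb = (r b').adjugate := hstar b' sb rfl
  have hdet : (r b').det = 0 := by
    have hz : r (sb * b') = 0 := (hr _).2 hnrd
    rw [map_mul, hsb, Matrix.adjugate_mul] at hz
    simpa using congr($hz 0 0)
  obtain ⟨a, ha⟩ := exists_mul_eq_smul_of_adjugate_mul_eq_zero hdet (m := r y') <| by
    rw [← hsb, ← map_mul, ← map_mul, ← mul_assoc]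
    exact (hr _).2 h
  obtain ⟨a, rfl⟩ := ZMod.intCast_surjective a
  refine ⟨a, ?_⟩
  have hmem := (hr (y' * b' - a • b')).1 <| by
    rw [map_sub, map_mul, map_zsmul, ha, Int.cast_smul_eq_zsmul, sub_self]
  rwa [sub_mul, smul_mul_assoc, one_mul, Int.cast_smul_eq_zsmul]

end SplitPrimes

section SplitIndex

variable {K : Type*} [Field K] [NumberField K] {α β : ℚ} {O : Subring ℍ[ℚ,α,β]} {p : ℕ}
  [hp : Fact p.Prime]

theorem isIntegral_of_coprime_smul {z : K} {k l : ℕ} (hkl : k.Coprime l)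
    (hk : IsIntegral ℤ ((k : ℚ) • z)) (hl : IsIntegral ℤ ((l : ℚ) • z)) : IsIntegral ℤ z :=
  mem_of_coprime_smul_mem (O := (integralClosure ℤ K).toSubring) hkl hk hl

theorem smul_conjEmbedding_gen_notMem (hα : α ≠ 0) (hβ : β ≠ 0) (hO : IsMaximalOrder O)
    (hsplit : ¬ IsRamifiedAt ℍ[ℚ,α,β] p) {Δ : ℤ} {s : K} (h : IsImaginaryQuadratic Δ s)
    {φ : K →ₐ[ℚ] ℍ[ℚ,α,β]} (hφ : ∀ a : 𝓞 K, φ a ∈ O) (b : (ℍ[ℚ,α,β])ˣ) {M : ℕ}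
    (hM : leftIdealIndex hO.prop φ hφ b = p * M) :
    (M : ℚ) • conjEmbedding φ b s ∉ O := by
  intro hmem
  have hp0 : (p : ℚ) ≠ 0 := Nat.cast_ne_zero.2 hp.out.ne_zero
  obtain ⟨c, k, hk, hcO, hc, hnrd, hint⟩ :=
    exists_coprime_representative hO.prop φ hφ b h.finrank hp.out.ne_zero
  obtain ⟨l, hl⟩ : ∃ l : ℤ, (p : ℚ)⁻¹ * nrd (c : ℍ[ℚ,α,β]) = l * M := by
    rw [hM] at hnrd
    rcases eq_or_eq_neg_of_abs_eq hnrd with h' | h'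
    · exact ⟨k, by rw [h']; push_cast; field_simp⟩
    · exact ⟨-k, by rw [h']; push_cast; field_simp⟩
  obtain ⟨a, ha⟩ := hO.exists_inv_smul_sub_mul_mem hα hβ hsplit
    (hφ ⟨s, h.isIntegral_gen⟩) hcO (by
      rw [star_mul_self_eq, smul_smul, hl, mul_smul]
      exact intCast_smul_mem _ (natCast_smul_mem _ O.one_mem)) (by
      rw [star_mul_map_mul_eq, hc, smul_smul, hl, mul_smul]
      exact intCast_smul_mem _ hmem)
  refine h.not_isIntegral_sub_div hp.out a (isIntegral_of_coprime_smul hk (hint _ ?_) ?_)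
  · rwa [map_smul, map_sub, map_smul, map_one, smul_mul_assoc]
  · rw [smul_inv_smul₀ hp0]
    exact h.isIntegral_gen.sub (intCast_smul_mem (O := (integralClosure ℤ K).toSubring) a
      (one_mem _))

end SplitIndex

section Splitting

variable {α β : ℚ} {F : Type*} [Field F] [Algebra ℚ F]

theorem nonempty_algEquiv_matrix_of_algHom (hα : α ≠ 0) (hβ : β ≠ 0)
    (f : ℍ[ℚ,α,β] →ₐ[ℚ] Matrix (Fin 2) (Fin 2) F) :
    Nonempty ((F ⊗[ℚ] ℍ[ℚ,α,β]) ≃ₐ[F] Matrix (Fin 2) (Fin 2) F) := by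
  let g : F ⊗[ℚ] ℍ[ℚ,α,β] →ₐ[F] Matrix (Fin 2) (Fin 2) F :=
    Algebra.TensorProduct.lift (Algebra.ofId F _) f fun x _ => Algebra.commutes x _
  have hg (x : ℍ[ℚ,α,β]) : g (1 ⊗ₜ x) = f x :=
    (Algebra.TensorProduct.lift_tmul _ _ _ _ _).trans (by simp)
  let b := QuaternionAlgebra.basisOneIJK α 0 β
  let d := (trdForm α β).dualBasis (trdForm_nondegenerate hα hβ) b
  have hbd (i j) : (f (b i) * f (d j)).trace = if i = j then 1 else 0 := by
    rw [← map_mul, trace_map_eq_trd hα hβ, ← trdForm_apply,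
      LinearMap.BilinForm.apply_dualBasis_right _ trdForm_isSymm]
    simp only [apply_ite (algebraMap ℚ F), map_one, map_zero]
  have hinj : Function.Injective g := by
    refine (injective_iff_map_eq_zero g).2 fun x hx => (b.baseChange F).ext_elem fun j => ?_
    have hsum : ((g x) * f (d j)).trace = (b.baseChange F).repr x j := by
      conv_lhs => rw [← (b.baseChange F).sum_repr x]
      simp [map_sum, Finset.sum_mul, Matrix.trace_sum, hg, hbd]
    rw [← hsum, hx, zero_mul, Matrix.trace_zero, map_zero, Finsupp.zero_apply]
  have hfin : Module.finrank F (F ⊗[ℚ] ℍ[ℚ,α,β]) = Module.finrank F (Matrix (Fin 2) (Fin 2) F) := by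
    rw [Module.finrank_baseChange, QuaternionAlgebra.finrank_eq_four, Module.finrank_matrix]
    simp
  exact ⟨.ofBijective g ⟨hinj, (LinearMap.injective_iff_surjective_of_finrank_eq_finrank
    (f := g.toLinearMap) hfin).1 hinj⟩⟩

theorem nonempty_algHom_matrix_of_eq_sq {r : F} (hr : algebraMap ℚ F α = r ^ 2) :
    Nonempty (ℍ[ℚ,α,β] →ₐ[ℚ] Matrix (Fin 2) (Fin 2) F) := by
  let q : QuaternionAlgebra.Basis (Matrix (Fin 2) (Fin 2) F) α 0 β :=
    { i := !![r, 0; 0, -r]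
      j := !![0, algebraMap ℚ F β; 1, 0]
      k := !![r, 0; 0, -r] * !![0, algebraMap ℚ F β; 1, 0]
      i_mul_i := by
        ext i j; fin_cases i <;> fin_cases j <;>
          simp [Matrix.mul_apply, Fin.sum_univ_two, Algebra.smul_def,
            Matrix.algebraMap_matrix_apply, -eq_ratCast, hr, pow_two]
      j_mul_j := by
        ext i j; fin_cases i <;> fin_cases j <;>
          simp [Matrix.mul_apply, Fin.sum_univ_two, Algebra.smul_def]
      i_mul_j := rfl
      j_mul_i := by
        ext i j; fin_cases i <;> fin_cases j <;>
          simp [Matrix.mul_apply, Fin.sum_univ_two, mul_comm] }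
  exact ⟨q.liftHom⟩

theorem nonempty_algHom_matrix_of_eq_norm {u v : F}
    (h : algebraMap ℚ F β = u ^ 2 - algebraMap ℚ F α * v ^ 2) :
    Nonempty (ℍ[ℚ,α,β] →ₐ[ℚ] Matrix (Fin 2) (Fin 2) F) := by
  let a := algebraMap ℚ F α
  let q : QuaternionAlgebra.Basis (Matrix (Fin 2) (Fin 2) F) α 0 β :=
    { i := !![0, a; 1, 0]
      j := !![u, -a * v; v, -u]
      k := !![0, a; 1, 0] * !![u, -a * v; v, -u]
      i_mul_i := by
        ext i j; fin_cases i <;> fin_cases j <;>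
          simp [a, Matrix.mul_apply, Fin.sum_univ_two, Algebra.smul_def,
            Matrix.algebraMap_matrix_apply]
      j_mul_j := by
        ext i j; fin_cases i <;> fin_cases j <;>
          simp [a, Matrix.mul_apply, Fin.sum_univ_two, Algebra.smul_def,
            -eq_ratCast, h] <;> ring
      i_mul_j := rfl
      j_mul_i := by
        ext i j; fin_cases i <;> fin_cases j <;>
          simp [Matrix.mul_apply, Fin.sum_univ_two, mul_comm] }
  exact ⟨q.liftHom⟩

theorem nonempty_algHom_matrix_of_isotropic {x y z w : F} (hne : ¬ (x = 0 ∧ y = 0 ∧ z = 0 ∧ w = 0))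
    (h : x ^ 2 - algebraMap ℚ F α * y ^ 2 - algebraMap ℚ F β * z ^ 2 +
      algebraMap ℚ F α * algebraMap ℚ F β * w ^ 2 = 0) :
    Nonempty (ℍ[ℚ,α,β] →ₐ[ℚ] Matrix (Fin 2) (Fin 2) F) := by
  set a := algebraMap ℚ F α with ha
  by_cases hn : z ^ 2 - a * w ^ 2 = 0
  · by_cases hw : w = 0
    · have hz : z = 0 := by simpa [hw] using hn
      have hy : y ≠ 0 := fun hy => hne ⟨by simpa [hy, hz, hw] using h, hy, hz, hw⟩
      refine nonempty_algHom_matrix_of_eq_sq (r := x / y) ?_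
      rw [← ha, div_pow, eq_div_iff (pow_ne_zero 2 hy)]
      linear_combination -h - algebraMap ℚ F β * hn
    · refine nonempty_algHom_matrix_of_eq_sq (r := z / w) ?_
      rw [← ha, div_pow, eq_div_iff (pow_ne_zero 2 hw)]
      linear_combination -hn
  · -- `β` is the quotient of the norms `x² - a y²` and `z² - a w²`.
    refine nonempty_algHom_matrix_of_eq_norm (u := (x * z - a * y * w) / (z ^ 2 - a * w ^ 2))
      (v := (y * z - x * w) / (z ^ 2 - a * w ^ 2)) ?_
    rw [← ha]
    field_simp
    linear_combination (-z ^ 2 + a * w ^ 2) * h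

end Splitting

section Ramified

variable {α β : ℚ} {p : ℕ} [hp : Fact p.Prime]

theorem nrd_add (x y : ℍ[ℚ,α,β]) : nrd (x + y) = nrd x + nrd y + trd (x * star y) := by
  simp [nrd_eq, trd_eq]; ring

theorem exists_padicInt_sq_sub_add_eq_zero {n : ℤ_[p]} (hn : ‖n‖ < 1) :
    ∃ r : ℤ_[p], ‖r‖ < 1 ∧ r ^ 2 - r + n = 0 := by
  let F : Polynomial ℤ_[p] := .X ^ 2 - .X + .C n
  have hF : ‖F.aeval (0 : ℤ_[p])‖ < ‖F.derivative.aeval (0 : ℤ_[p])‖ ^ 2 := by simpa [F] using hn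
  obtain ⟨r, hr, hlt, -⟩ := hensels_lemma hF
  exact ⟨r, by simpa [F] using hlt, by simpa [F] using hr⟩

/-- Otherwise the characteristic polynomial of `y / Trd(y)` is reducible over `ℚ_p` by Hensel's
lemma, and the norm form of `B` is isotropic. -/
theorem norm_trd_sq_le_norm_nrd (hα : α ≠ 0) (hβ : β ≠ 0) (hram : IsRamifiedAt ℍ[ℚ,α,β] p)
    (y : ℍ[ℚ,α,β]) : ‖(trd y : ℚ_[p])‖ ^ 2 ≤ ‖(nrd y : ℚ_[p])‖ := by
  by_contra! hlt
  have hy : trd y ≠ 0 := fun h => by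
    rw [h, Rat.cast_zero, norm_zero, zero_pow two_ne_zero] at hlt
    exact hlt.not_ge (norm_nonneg _)
  let z := (trd y)⁻¹ • y
  have hz : z.re = 1 / 2 := by
    have := trd_eq z
    rw [trd_smul, inv_mul_cancel₀ hy] at this
    linarith
  have hn : ‖(nrd z : ℚ_[p])‖ < 1 := by
    have : (trd y : ℚ_[p]) ≠ 0 := by exact_mod_cast hy
    rw [nrd_smul, Rat.cast_mul, Rat.cast_pow, Rat.cast_inv, norm_mul, norm_pow, norm_inv, inv_pow,
      inv_mul_lt_one₀ (by positivity)]
    exact hlt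
  obtain ⟨r, hr, hroot⟩ := exists_padicInt_sq_sub_add_eq_zero (n := ⟨(nrd z : ℚ_[p]), hn.le⟩) hn
  have hroot' : (r : ℚ_[p]) ^ 2 - r + nrd z = 0 := by exact_mod_cast congr(($hroot : ℚ_[p]))
  obtain ⟨f⟩ := nonempty_algHom_matrix_of_isotropic (α := α) (β := β) (F := ℚ_[p])
    (x := z.re - r) (y := z.imI) (z := z.imJ) (w := z.imK) (by
      rintro ⟨h, -⟩
      have h2 : (2 * r : ℤ_[p]) = 1 := by
        rw [hz, sub_eq_zero] at h
        refine PadicInt.ext ?_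
        rw [PadicInt.coe_mul, ← h]
        change (2 : ℚ_[p]) * ((1 / 2 : ℚ) : ℚ_[p]) = 1
        norm_num
      have : ‖(2 * r : ℤ_[p])‖ < 1 := by
        rw [norm_mul]
        exact mul_lt_one_of_nonneg_of_lt_one_right (PadicInt.norm_le_one 2) (norm_nonneg r) hr
      rw [h2, norm_one] at this
      exact this.false) (by
      have h := congr(($(nrd_eq z) : ℚ_[p]))
      push_cast at h
      rw [hz] at h ⊢
      simp only [eq_ratCast]
      push_cast at h ⊢
      linear_combination hroot' - h)
  exact hram (nonempty_algEquiv_matrix_of_algHom hα hβ f)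

section Ultrametric

variable (hα : α ≠ 0) (hβ : β ≠ 0) (hram : IsRamifiedAt ℍ[ℚ,α,β] p)
include hα hβ hram

theorem norm_nrd_add_le (x y : ℍ[ℚ,α,β]) :
    ‖(nrd (x + y) : ℚ_[p])‖ ≤ max ‖(nrd x : ℚ_[p])‖ ‖(nrd y : ℚ_[p])‖ := by
  set a := ‖(nrd x : ℚ_[p])‖
  set b := ‖(nrd y : ℚ_[p])‖
  have htr : ‖(trd (x * star y) : ℚ_[p])‖ ≤ max a b := by
    have h := norm_trd_sq_le_norm_nrd hα hβ hram (x * star y)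
    rw [nrd_mul, nrd_star, Rat.cast_mul, norm_mul] at h
    refine le_of_sq_le_sq (h.trans ?_) (le_max_of_le_left (norm_nonneg _))
    rw [pow_two]
    exact mul_le_mul (le_max_left _ _) (le_max_right _ _) (norm_nonneg _)
      (le_max_of_le_left (norm_nonneg _))
  rw [nrd_add, Rat.cast_add, Rat.cast_add]
  exact (Padic.nonarchimedean _ _).trans (max_le (Padic.nonarchimedean _ _) htr)

/-- The valuation ring `{x | |Nrd(x)|_p ≤ 1}` of `B` at a ramified prime `p`. -/
def ramifiedValuationRing : Subring ℍ[ℚ,α,β] where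
  carrier := {x | ‖(nrd x : ℚ_[p])‖ ≤ 1}
  mul_mem' {x y} hx hy := by
    simpa using mul_le_one₀ hx (norm_nonneg _) hy
  one_mem' := by simp
  add_mem' {x y} hx hy := (norm_nrd_add_le hα hβ hram x y).trans (max_le hx hy)
  zero_mem' := by simp
  neg_mem' {x} hx := by simpa [nrd_eq] using hx

theorem norm_trd_le_one {y : ℍ[ℚ,α,β]} (hy : ‖(nrd y : ℚ_[p])‖ ≤ 1) : ‖(trd y : ℚ_[p])‖ ≤ 1 :=
  (sq_le_one_iff₀ (norm_nonneg _)).1 ((norm_trd_sq_le_norm_nrd hα hβ hram y).trans hy)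

theorem IsMaximalOrder.exists_coprime_smul_mem {O : Subring ℍ[ℚ,α,β]} (hO : IsMaximalOrder O)
    {y : ℍ[ℚ,α,β]} (hy : ‖(nrd y : ℚ_[p])‖ ≤ 1) : ∃ M : ℕ, M.Coprime p ∧ (M : ℚ) • y ∈ O := by
  obtain ⟨M₀, hM₀, hmem⟩ := hO.prop.exists_natCast_smul_mem y
  obtain ⟨k, M, hM, rfl⟩ := Nat.exists_eq_pow_mul_and_not_dvd hM₀.ne' p hp.out.ne_one
  refine ⟨M, Nat.Coprime.symm ((Nat.Prime.coprime_iff_not_dvd hp.out).2 hM),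
    hO.mem_of_pow_smul_mem hα hβ (R := ramifiedValuationRing hα hβ hram)
      (fun x hx => norm_trd_le_one hα hβ hram hx) (fun x hx => ?_) (natCast_smul_mem M ?_) (k := k)
      ?_⟩
  · obtain ⟨n, hn⟩ := hO.prop.exists_nrd_eq hx
    change ‖(nrd x : ℚ_[p])‖ ≤ 1
    rw [hn, Rat.cast_intCast]
    exact Padic.norm_int_le_one n
  · exact hy
  · rwa [smul_smul, ← Nat.cast_mul]

end Ultrametric

end Ramified

section RamifiedIndex

variable {α β : ℚ} {p : ℕ} [hp : Fact p.Prime]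

theorem trd_commutator_mul_star_eq_zero (t b : ℍ[ℚ,α,β]) (u v : ℚ) :
    trd ((t * b - b * t) * star (u • 1 + v • t)) = 0 := by
  simp [trd_eq]; ring

theorem nrd_commutator {t : ℍ[ℚ,α,β]} (ht : trd t = 0) (b : ℍ[ℚ,α,β]) :
    nrd (t * b - b * t) = 4 * nrd t * nrd b - trd (t * b) ^ 2 - nrd t * trd b ^ 2 := by
  have hre : t.re = 0 := by simpa [trd_eq] using ht
  simp [nrd_eq, trd_eq, hre]; ring

theorem exists_dvd_sq_sub_mul_sq_add (hp2 : p ≠ 2) {d : ℤ} (hd : ¬ (p : ℤ) ∣ d) (n : ℤ) :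
    ∃ u v : ℤ, (p : ℤ) ∣ u ^ 2 - d * v ^ 2 + n := by
  have hd0 : (-d : ZMod p) ≠ 0 := by rwa [neg_ne_zero, Ne, ZMod.intCast_zmod_eq_zero_iff_dvd]
  obtain ⟨x, y, hxy⟩ := FiniteField.exists_root_sum_quadratic
    (f := (.X ^ 2 + .C (n : ZMod p) : Polynomial (ZMod p)))
    (g := .C (-d : ZMod p) * .X ^ 2)
    (Polynomial.degree_X_pow_add_C two_pos _) (Polynomial.degree_C_mul_X_pow 2 hd0)
    (by rw [ZMod.card]; exact Nat.odd_iff.1 (hp.out.odd_of_ne_two hp2))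
  obtain ⟨u, rfl⟩ := ZMod.intCast_surjective x
  obtain ⟨v, rfl⟩ := ZMod.intCast_surjective y
  refine ⟨u, v, (ZMod.intCast_zmod_eq_zero_iff_dvd _ p).1 ?_⟩
  push_cast
  simp only [Polynomial.eval_add, Polynomial.eval_mul, Polynomial.eval_pow, Polynomial.eval_X,
    Polynomial.eval_C] at hxy
  linear_combination hxy

theorem sq_dvd_of_mul_eq {m n : ℤ} {q : ℚ_[p]} (h : m * q = n) (hm : (p : ℤ) ∣ m)
    (hq : ‖q‖ < 1) : (p : ℤ) ^ 2 ∣ n := by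
  have hm' : ‖(m : ℚ_[p])‖ ≤ (p : ℝ) ^ (-(1 : ℕ) : ℤ) :=
    (Padic.norm_int_le_pow_iff_dvd m 1).2 (by simpa using hm)
  have hq' : ‖q‖ ≤ (p : ℝ) ^ (-(1 : ℕ) : ℤ) := by
    rw [Padic.norm_le_pow_iff_norm_lt_pow_add_one]
    simpa using hq
  have hn := mul_le_mul hm' hq' (norm_nonneg _) (by positivity)
  have hp0 : (p : ℝ) ≠ 0 := Nat.cast_ne_zero.2 hp.out.ne_zero
  rw [← norm_mul, h, ← zpow_add₀ hp0] at hn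
  exact_mod_cast (Padic.norm_int_le_pow_iff_dvd n 2).1 hn

theorem dvd_trd_of_dvd_nrd (hα : α ≠ 0) (hβ : β ≠ 0) (hram : IsRamifiedAt ℍ[ℚ,α,β] p)
    {y : ℍ[ℚ,α,β]} {n t : ℤ} (hn : nrd y = n) (ht : trd y = t) (h : (p : ℤ) ∣ n) :
    (p : ℤ) ∣ t := by
  have hle := norm_trd_sq_le_norm_nrd hα hβ hram y
  rw [hn, ht, Rat.cast_intCast, Rat.cast_intCast] at hle
  rw [← Padic.norm_intCast_lt_one_iff] at h ⊢
  exact (sq_lt_one_iff₀ (norm_nonneg _)).1 (hle.trans_lt h)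

variable {K : Type*} [Field K] [NumberField K] {O : Subring ℍ[ℚ,α,β]}

theorem IsImaginaryQuadratic.trd_map_gen {Δ : ℤ} {s : K} (h : IsImaginaryQuadratic Δ s)
    (φ : K →ₐ[ℚ] ℍ[ℚ,α,β]) : trd (φ s) = 0 :=
  (trd_map_and_nrd_map h.finrank φ s).1.trans h.trace_gen

theorem IsImaginaryQuadratic.nrd_map_gen {Δ : ℤ} {s : K} (h : IsImaginaryQuadratic Δ s)
    (φ : K →ₐ[ℚ] ℍ[ℚ,α,β]) : nrd (φ s) = -Δ := by
  have hs := h.norm_coords 0 1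
  rw [zero_smul, zero_add, one_smul] at hs
  rw [(trd_map_and_nrd_map h.finrank φ s).2, hs]
  ring

variable (hα : α ≠ 0) (hβ : β ≠ 0) (hram : IsRamifiedAt ℍ[ℚ,α,β] p) {Δ : ℤ} {s : K}
  (h : IsImaginaryQuadratic Δ s) (hinert : (Ideal.span {(p : 𝓞 K)}).IsPrime)
  (φ : K →ₐ[ℚ] ℍ[ℚ,α,β])

include hα hβ hram h hinert

/-- Otherwise some `y = (w + φ(x)) φ(x)*`, with `w` the commutator, has `p ∣ Nrd(y)` and
`p ∤ Trd(y)`. -/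
theorem dvd_nrd_commutator {b : ℍ[ℚ,α,β]} {n : ℤ} (hn : nrd (φ s * b - b * φ s) = n) :
    (p : ℤ) ∣ n := by
  by_contra hpn
  have hpi : Prime (p : ℤ) := Nat.prime_iff_prime_int.1 hp.out
  have h2Δ := h.not_dvd_two_mul_of_inert hp.out hinert
  obtain ⟨u, v, huv⟩ := exists_dvd_sq_sub_mul_sq_add (p := p)
    (fun h2 => h2Δ (h2 ▸ dvd_mul_right _ _)) (fun hΔ => h2Δ (hΔ.mul_left 2)) n
  set N := u ^ 2 - Δ * v ^ 2 with hN
  set w := φ s * b - b * φ s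
  have hx : φ ((u : ℚ) • 1 + (v : ℚ) • s) = (u : ℚ) • 1 + (v : ℚ) • φ s := by
    rw [map_add, map_smul, map_smul, map_one]
  have hnx : nrd ((u : ℚ) • 1 + (v : ℚ) • φ s) = N := by
    rw [← hx, (trd_map_and_nrd_map h.finrank φ _).2, h.norm_coords, hN]
    push_cast; rfl
  have hwx := trd_commutator_mul_star_eq_zero (φ s) b u v
  set x := (u : ℚ) • 1 + (v : ℚ) • φ s
  have hnrd : nrd ((w + x) * star x) = ((N + n) * N : ℤ) := by
    rw [nrd_mul, nrd_star, nrd_add, hwx, hnx, hn]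
    push_cast; ring
  have htrd : trd ((w + x) * star x) = (2 * N : ℤ) := by
    rw [add_mul, trd_add, hwx, mul_star_self_eq, trd_smul, trd_one, hnx]
    push_cast; ring
  rcases hpi.dvd_or_dvd (dvd_trd_of_dvd_nrd hα hβ hram hnrd htrd (huv.mul_right N)) with h2 | hpN
  · exact h2Δ (h2.mul_right Δ)
  · exact hpn ((dvd_add_right hpN).1 huv)

omit hα hβ hram in
theorem sq_dvd_nrd_of_sq_dvd_nrd_commutator {b : ℍ[ℚ,α,β]} {m n u v : ℤ} (hm : nrd b = m)
    (hn : nrd (φ s * b - b * φ s) = n) (hu : trd (φ s * b) = u) (hv : trd b = v)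
    (hpm : (p : ℤ) ∣ m) (hpn : (p : ℤ) ^ 2 ∣ n) : (p : ℤ) ^ 2 ∣ m := by
  have hpi : Prime (p : ℤ) := Nat.prime_iff_prime_int.1 hp.out
  have h2Δ := h.not_dvd_two_mul_of_inert hp.out hinert
  have hid : -4 * Δ * m = n + (u ^ 2 - Δ * v ^ 2) := by
    have hw := nrd_commutator (h.trd_map_gen φ) b
    rw [hn, h.nrd_map_gen φ, hm, hu, hv] at hw
    exact_mod_cast (by linear_combination -hw : (-4 * Δ * m : ℚ) = n + (u ^ 2 - Δ * v ^ 2))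
  have huv : (p : ℤ) ∣ u ^ 2 - Δ * v ^ 2 :=
    (dvd_add_right ((dvd_pow_self _ two_ne_zero).trans hpn)).1 (hid ▸ hpm.mul_left _)
  obtain ⟨hpu, hpv⟩ := h.dvd_and_dvd_of_dvd_sq_sub hp.out hinert huv
  have hdvd : (p : ℤ) ^ 2 ∣ -4 * Δ * m :=
    hid ▸ dvd_add hpn (dvd_sub (pow_dvd_pow_of_dvd hpu 2) ((pow_dvd_pow_of_dvd hpv 2).mul_left Δ))
  refine hpi.pow_dvd_of_dvd_mul_left 2 (fun hd => h2Δ ?_) hdvd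
  rcases hpi.dvd_or_dvd hd with h4 | hΔ
  · exact (hpi.dvd_of_dvd_pow (n := 2) (by simpa using h4)).mul_right Δ
  · exact hΔ.mul_left 2

variable (hO : IsMaximalOrder O) {φ} (hφ : ∀ a : 𝓞 K, φ a ∈ O) (b : (ℍ[ℚ,α,β])ˣ) {N : ℕ}
  (hN : leftIdealIndex hO.prop φ hφ b = N)

include hN

omit hinert in
theorem not_sq_dvd_leftIdealIndex : ¬ p ^ 2 ∣ N := by
  rintro ⟨N', rfl⟩
  have hp0 : (p : ℚ) ≠ 0 := Nat.cast_ne_zero.2 hp.out.ne_zero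
  obtain ⟨c, k, hk, -, -, hnrd, hint⟩ :=
    exists_coprime_representative hO.prop φ hφ b h.finrank hp.out.ne_zero
  have hle : ‖(nrd ((p : ℚ)⁻¹ • (c : ℍ[ℚ,α,β])) : ℚ_[p])‖ ≤ 1 := by
    have habs : |nrd ((p : ℚ)⁻¹ • (c : ℍ[ℚ,α,β]))| = ((k * N' : ℕ) : ℤ) := by
      rw [nrd_smul, abs_mul, hnrd, hN, abs_of_nonneg (by positivity)]
      push_cast
      field_simp
    rcases eq_or_eq_neg_of_abs_eq habs with h' | h' <;>
      simpa only [h', Rat.cast_neg, norm_neg, Rat.cast_intCast] using Padic.norm_int_le_one _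
  obtain ⟨M, hM, hmem⟩ := hO.exists_coprime_smul_mem hα hβ hram hle
  refine h.not_isIntegral_sub_div hp.out 0
    (isIntegral_of_coprime_smul (k := k * M) (Nat.Coprime.mul_left hk hM) ?_ ?_)
  · rw [Nat.cast_mul, mul_smul]
    refine hint _ ?_
    have hsmem : φ s * ((M : ℚ) • (p : ℚ)⁻¹ • (c : ℍ[ℚ,α,β])) ∈ O :=
      O.mul_mem (hφ ⟨s, h.isIntegral_gen⟩) hmem
    simpa [smul_mul_assoc, mul_smul_comm] using hsmem
  · rw [smul_inv_smul₀ hp0]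
    simpa using h.isIntegral_gen

theorem norm_nrd_sub_conjEmbedding_lt_one_iff :
    ‖(nrd (φ s - conjEmbedding φ b s) : ℚ_[p])‖ < 1 ↔ ¬ p ∣ N := by
  obtain ⟨c, k, hk, hcO, hc, hnrd, -⟩ :=
    exists_coprime_representative hO.prop φ hφ b h.finrank hp.out.ne_zero
  have hsO : φ s ∈ O := hφ ⟨s, h.isIntegral_gen⟩
  obtain ⟨m, hm⟩ := hO.prop.exists_nrd_eq hcO
  obtain ⟨n, hn⟩ := hO.prop.exists_nrd_eq (sub_mem (mul_mem hsO hcO) (mul_mem hcO hsO))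
  obtain ⟨u, hu⟩ := hO.prop.exists_trd_eq (mul_mem hsO hcO)
  obtain ⟨v, hv⟩ := hO.prop.exists_trd_eq hcO
  have hmN : m.natAbs = k * N := by
    rw [hN, hm] at hnrd
    zify
    exact_mod_cast hnrd
  have hmul : c * (conjEmbedding φ b s - φ s) = φ s * c - c * φ s := by
    rw [← hc, conjEmbedding_apply, mul_sub, mul_assoc, Units.mul_inv_cancel_left]
  have hprod : (m : ℚ_[p]) * nrd (φ s - conjEmbedding φ b s) = n := by
    have h' := congr((nrd $hmul : ℚ_[p]))
    rw [nrd_mul, hm, hn, ← neg_sub, ← neg_one_smul ℚ, nrd_smul] at h'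
    simpa using h'
  have hpn := dvd_nrd_commutator hα hβ hram h hinert φ hn
  rw [← Padic.norm_intCast_lt_one_iff] at hpn
  refine ⟨fun hlt hpN => ?_, fun hpN => ?_⟩
  · have hpm : (p : ℤ) ∣ m := Int.natCast_dvd.2 (hmN ▸ hpN.mul_left k)
    have := sq_dvd_nrd_of_sq_dvd_nrd_commutator h hinert φ hm hn hu hv hpm
      (sq_dvd_of_mul_eq hprod hpm hlt)
    rw [← Nat.cast_pow, Int.natCast_dvd, hmN] at this
    exact not_sq_dvd_leftIdealIndex hα hβ hram h hO hφ b hN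
      (((Nat.Coprime.pow_right 2 hk).symm).dvd_of_dvd_mul_left this)
  · have hm1 : ‖(m : ℚ_[p])‖ = 1 := by
      rw [Padic.norm_intCast_eq_one_iff, Int.isCoprime_iff_gcd_eq_one, Int.gcd, hmN]
      exact hk.mul_left ((Nat.Prime.coprime_iff_not_dvd hp.out).2 hpN).symm
    rwa [← hprod, norm_mul, hm1, one_mul] at hpn

end RamifiedIndex

section LocalOrder

variable {α β : ℚ} {O : Subring ℍ[ℚ,α,β]} {p : ℕ} [hp : Fact p.Prime]

theorem tmul_mem_localOrder {b : ℍ[ℚ,α,β]} (hb : b ∈ O) : (1 : ℚ_[p]) ⊗ₜ[ℚ] b ∈ localOrder O p :=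
  Submodule.subset_span ⟨b, hb, rfl⟩

theorem mul_mem_localOrder {x y : ℚ_[p] ⊗[ℚ] ℍ[ℚ,α,β]} (hx : x ∈ localOrder O p)
    (hy : y ∈ localOrder O p) : x * y ∈ localOrder O p := by
  have h := Submodule.mul_mem_mul hx hy
  rw [localOrder, Submodule.span_mul_span] at h
  refine Submodule.span_mono ?_ h
  rintro _ ⟨_, ⟨a, ha, rfl⟩, _, ⟨b, hb, rfl⟩, rfl⟩
  exact ⟨a * b, mul_mem ha hb, by simp⟩

theorem tmul_mem_localOrder_of_coprime_smul_mem {z : ℍ[ℚ,α,β]} {M : ℕ} (hM : M.Coprime p)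
    (hz : (M : ℚ) • z ∈ O) : (1 : ℚ_[p]) ⊗ₜ[ℚ] z ∈ localOrder O p := by
  have hunit : IsUnit (M : ℤ_[p]) := by
    rw [PadicInt.isUnit_iff]
    exact_mod_cast (Padic.norm_natCast_eq_one_iff (p := p)).2 hM.symm
  obtain ⟨w, hw⟩ := hunit.exists_left_inv
  have hw' : (w : ℚ_[p]) * M = 1 := by exact_mod_cast congr(($hw : ℚ_[p]))
  have hwz : w • ((1 : ℚ_[p]) ⊗ₜ[ℚ] ((M : ℚ) • z)) = (1 : ℚ_[p]) ⊗ₜ[ℚ] z := by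
    change (w : ℚ_[p]) • ((1 : ℚ_[p]) ⊗ₜ[ℚ] ((M : ℚ) • z)) = _
    have hM1 : (M : ℚ) • (1 : ℚ_[p]) = M := by simp [Algebra.smul_def]
    rw [← TensorProduct.smul_tmul, hM1, TensorProduct.smul_tmul', smul_eq_mul, hw']
  exact hwz ▸ Submodule.smul_mem _ w (tmul_mem_localOrder hz)

theorem norm_trd_le_one_of_mem_localOrder (hO : IsOrder O) {z : ℍ[ℚ,α,β]}
    (hz : (1 : ℚ_[p]) ⊗ₜ[ℚ] z ∈ localOrder O p) : ‖(trd z : ℚ_[p])‖ ≤ 1 := by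
  let T : (ℚ_[p] ⊗[ℚ] ℍ[ℚ,α,β]) →ₗ[ℚ_[p]] ℚ_[p] :=
    (TensorProduct.AlgebraTensorModule.rid ℚ ℚ_[p] ℚ_[p]).toLinearMap ∘ₗ
      (trdForm α β 1).baseChange ℚ_[p]
  have hT (b : ℍ[ℚ,α,β]) : T (1 ⊗ₜ b) = trd b := by
    simp [T, trdForm_apply, Algebra.smul_def]
  have hle : localOrder O p ≤
      (1 : Submodule ℤ_[p] ℚ_[p]).comap (T.restrictScalars ℤ_[p]) := by
    refine Submodule.span_le.2 ?_
    rintro _ ⟨b, hb, rfl⟩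
    obtain ⟨n, hn⟩ := hO.exists_trd_eq hb
    refine Submodule.mem_one.2 ⟨n, ?_⟩
    simp [hT, hn]
  obtain ⟨c, hc⟩ := Submodule.mem_one.1 (hle hz)
  have hc' : (c : ℚ_[p]) = trd z := hc.trans (hT z)
  exact hc' ▸ c.norm_le_one

theorem norm_nrd_le_one_of_mem_localOrder (hO : IsOrder O) (hp2 : p ≠ 2) {z : ℍ[ℚ,α,β]}
    (hz : (1 : ℚ_[p]) ⊗ₜ[ℚ] z ∈ localOrder O p) : ‖(nrd z : ℚ_[p])‖ ≤ 1 := by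
  have hzz := mul_mem_localOrder hz hz
  rw [Algebra.TensorProduct.tmul_mul_tmul, one_mul] at hzz
  have htr : 2 * nrd z = trd z ^ 2 - trd (z * z) := by simp [nrd_eq, trd_eq]; ring
  have h2 : ‖(2 : ℚ_[p])‖ = 1 := by
    exact_mod_cast Padic.norm_natCast_eq_one_iff.2
      ((Nat.coprime_primes hp.out Nat.prime_two).2 hp2)
  have htr' := congr((‖($htr : ℚ_[p])‖))
  push_cast at htr'
  rw [norm_mul, h2, one_mul] at htr'
  rw [htr', sub_eq_add_neg]
  refine (Padic.nonarchimedean _ _).trans (max_le ?_ ?_)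
  · rw [norm_pow]
    exact pow_le_one₀ (norm_nonneg _) (norm_trd_le_one_of_mem_localOrder hO hz)
  · rw [norm_neg]
    exact norm_trd_le_one_of_mem_localOrder hO hzz

end LocalOrder

section SameReduction

variable {α β : ℚ} {O : Subring ℍ[ℚ,α,β]} {p : ℕ} [hp : Fact p.Prime]
  {K : Type*} [Field K] [NumberField K] {Δ : ℤ} {s : K}

theorem IsImaginaryQuadratic.exists_map_sub_map_eq (h : IsImaginaryQuadratic Δ s)
    (hpΔ : ¬ (p : ℤ) ∣ 2 * Δ) (i j : K →ₐ[ℚ] ℍ[ℚ,α,β]) (a : 𝓞 K) :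
    ∃ v : ℚ, ‖(v : ℚ_[p])‖ ≤ 1 ∧ i a - j a = v • (i s - j s) := by
  obtain ⟨u, v, ha⟩ := h.exists_coords (a : K)
  refine ⟨v, ?_, ?_⟩
  · obtain ⟨n, hn⟩ := IsIntegrallyClosed.isIntegral_iff.1
      (Algebra.isIntegral_trace (L := ℚ) (h.isIntegral_gen.mul a.isIntegral_coe))
    have hsa : s * a = (v * Δ) • (1 : K) + u • s := by
      rw [ha, mul_add, mul_smul_comm, mul_smul_comm, mul_one, ← pow_two, h.sq_eq_smul_one]
      module
    rw [hsa, h.trace_coords, eq_intCast] at hn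
    have hv : ((2 * Δ : ℤ) : ℚ_[p]) * v = n := by
      exact_mod_cast congr(($(show (2 * Δ : ℤ) * v = n by rw [hn]; push_cast; ring) : ℚ_[p]))
    have h1 : ‖((2 * Δ : ℤ) : ℚ_[p])‖ = 1 :=
      (Padic.norm_int_le_one _).antisymm (not_lt.1 fun hlt =>
        hpΔ ((Padic.norm_intCast_lt_one_iff).1 hlt))
    have hnv := congr(‖$hv‖)
    rw [norm_mul, h1, one_mul] at hnv
    exact hnv ▸ Padic.norm_int_le_one n
  · rw [ha]
    simp only [map_add, map_smul, map_one]
    module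

variable (hα : α ≠ 0) (hβ : β ≠ 0) (hram : IsRamifiedAt ℍ[ℚ,α,β] p) (hO : IsMaximalOrder O)
  (h : IsImaginaryQuadratic Δ s) (hpΔ : ¬ (p : ℤ) ∣ 2 * Δ)
  {θ : ℍ[ℚ,α,β]} (hθ : ‖(nrd θ : ℚ_[p])‖ = (p : ℝ)⁻¹) (i j : K →ₐ[ℚ] ℍ[ℚ,α,β])
include hα hβ hram hO h hpΔ hθ

theorem sameReduction_iff_norm_nrd_lt_one :
    SameReduction O θ i j p ↔ ‖(nrd (i s - j s) : ℚ_[p])‖ < 1 := by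
  have hp1 : (1 : ℝ) < p := by exact_mod_cast hp.out.one_lt
  obtain ⟨t, rfl⟩ := isUnit_of_nrd_ne_zero (x := θ) fun h0 => by
    rw [h0, Rat.cast_zero, norm_zero] at hθ
    exact (inv_pos.2 (zero_lt_one.trans hp1)).ne hθ
  constructor
  · intro hred
    have hp2 : p ≠ 2 := by rintro rfl; exact hpΔ (dvd_mul_right _ _)
    obtain ⟨x, hx, hxe⟩ := hred ⟨s, h.isIntegral_gen⟩
    replace hxe : (1 : ℚ_[p]) ⊗ₜ[ℚ] ((↑t⁻¹ : ℍ[ℚ,α,β]) * (i s - j s)) = x := by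
      have := congr((1 : ℚ_[p]) ⊗ₜ[ℚ] (↑t⁻¹ : ℍ[ℚ,α,β]) * $hxe)
      rwa [← mul_assoc, Algebra.TensorProduct.tmul_mul_tmul, Algebra.TensorProduct.tmul_mul_tmul,
        Units.inv_mul, one_mul, ← Algebra.TensorProduct.one_def, one_mul] at this
    have hle := norm_nrd_le_one_of_mem_localOrder hO.prop hp2 (hxe ▸ hx)
    rw [nrd_mul, nrd_coe_inv, Rat.cast_mul, Rat.cast_inv, norm_mul, norm_inv, hθ, inv_inv] at hle
    by_contra! hge
    exact hle.not_gt (hp1.trans_le (le_mul_of_one_le_right (zero_le_one.trans hp1.le) hge))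
  · intro hlt a
    obtain ⟨v, hv, hav⟩ := h.exists_map_sub_map_eq hpΔ i j a
    have hle : ‖(nrd (i s - j s) : ℚ_[p])‖ ≤ (p : ℝ)⁻¹ := by
      rw [← zpow_neg_one, Padic.norm_le_pow_iff_norm_lt_pow_add_one]
      simpa using hlt
    have hz : ‖(nrd ((↑t⁻¹ : ℍ[ℚ,α,β]) * (i a - j a)) : ℚ_[p])‖ ≤ 1 := by
      rw [hav, nrd_mul, nrd_coe_inv, nrd_smul]
      push_cast
      rw [norm_mul, norm_inv, hθ, inv_inv, norm_mul, norm_pow]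
      calc (p : ℝ) * (‖(v : ℚ_[p])‖ ^ 2 * ‖(nrd (i s - j s) : ℚ_[p])‖)
          ≤ p * (1 ^ 2 * (p : ℝ)⁻¹) := by gcongr
        _ = 1 := by field_simp
    obtain ⟨M, hM, hMz⟩ := hO.exists_coprime_smul_mem hα hβ hram hz
    refine ⟨_, tmul_mem_localOrder_of_coprime_smul_mem hM hMz, ?_⟩
    rw [Algebra.TensorProduct.tmul_mul_tmul, one_mul, Units.mul_inv_cancel_left]

end SameReduction

section IndexFormula

theorem sInf_pos_nsmul_eq_zero_eq_addOrderOf {G : Type*} [AddMonoid G] (x : G) :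
    sInf {n : ℕ | 0 < n ∧ n • x = 0} = addOrderOf x := by
  rw [addOrderOf, Function.minimalPeriod_eq_sInf_n_pos_IsPeriodicPt]
  simp_rw [isPeriodicPt_add_iff_nsmul_eq_zero]

variable {K : Type*} [Field K] [NumberField K] {α β : ℚ} {Δ : ℤ} {s : K}

theorem IsImaginaryQuadratic.algHom_ext {A : Type*} [Ring A] [Algebra ℚ A]
    (h : IsImaginaryQuadratic Δ s) {i j : K →ₐ[ℚ] A} (hs : i s = j s) : i = j := by
  ext x
  obtain ⟨u, v, rfl⟩ := h.exists_coords x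
  simp only [map_add, map_smul, map_one, hs]

theorem map_natCast_mul_eq_smul {A : Type*} [Ring A] [Algebra ℚ A] (i : K →ₐ[ℚ] A) (m : ℕ)
    (x : K) : i (m * x) = (m : ℚ) • i x := by
  rw [map_mul, map_natCast, Nat.cast_smul_eq_nsmul, nsmul_eq_mul]

variable {O : Subring ℍ[ℚ,α,β]} {m : ℕ} {ξ : ℍ[ℚ,α,β]} {i : K →ₐ[ℚ] ℍ[ℚ,α,β]}

theorem IsImaginaryQuadratic.eq_of_isInduced (h : IsImaginaryQuadratic Δ s) (hm : 0 < m)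
    (hi : IsInduced s m ξ i) {j : K →ₐ[ℚ] ℍ[ℚ,α,β]} (hj : IsInduced s m ξ j) : j = i := by
  refine h.algHom_ext (smul_right_injective _ (by positivity : (m : ℚ) ≠ 0) ?_)
  change (m : ℚ) • j s = (m : ℚ) • i s
  rw [← map_natCast_mul_eq_smul, ← map_natCast_mul_eq_smul]
  exact Eq.trans hj hi.symm

variable (h : IsImaginaryQuadratic Δ s) (hm : 0 < m)
include h hm

theorem conductor_dvd_iff (hi : IsInduced s m ξ i) {n : ℕ} :
    conductor s O m ξ ∣ n ↔ (n : ℚ) • i s ∈ O := by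
  have hmk (c : ℕ) : c • (i s : ℍ[ℚ,α,β] ⧸ O.toAddSubgroup) = 0 ↔ (c : ℚ) • i s ∈ O := by
    rw [← QuotientAddGroup.mk_nsmul, QuotientAddGroup.eq_zero_iff, Nat.cast_smul_eq_nsmul]
    rfl
  have hc : conductor s O m ξ = addOrderOf (i s : ℍ[ℚ,α,β] ⧸ O.toAddSubgroup) := by
    rw [conductor, ← sInf_pos_nsmul_eq_zero_eq_addOrderOf]
    congr! 4 with c
    rw [hmk, ← map_natCast_mul_eq_smul]
    constructor
    · rintro ⟨j, hj, hjO⟩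
      rw [← h.eq_of_isInduced hm hi hj]
      exact hjO _ (Algebra.subset_adjoin rfl)
    · refine fun hcO => ⟨i, hi, fun x hx => ?_⟩
      have hle : Algebra.adjoin ℤ {(c : K) * s} ≤
          (subalgebraOfSubring O).comap (i.restrictScalars ℤ) :=
        Algebra.adjoin_le (Set.singleton_subset_iff.2 hcO)
      exact hle hx
  rw [hc, addOrderOf_dvd_iff_nsmul_eq_zero, hmk]

theorem localFrobeniusType_eq_ite (hi : IsInduced s m ξ i) {θ : ℍ[ℚ,α,β]}
    {φ : K →ₐ[ℚ] ℍ[ℚ,α,β]} (p : ℕ) [Fact p.Prime] [Decidable (SameReduction O θ φ i p)] :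
    localFrobeniusType s O θ φ m ξ p = if SameReduction O θ φ i p then 1 else p := by
  have hiff : (∃ j, IsInduced s m ξ j ∧ SameReduction O θ φ j p) ↔ SameReduction O θ φ i p :=
    ⟨fun ⟨_, hj, hs⟩ => h.eq_of_isInduced hm hi hj ▸ hs, fun hs => ⟨i, hi, hs⟩⟩
  rw [localFrobeniusType]
  simp only [hiff]

omit h hm in
theorem norm_nrd_eq_inv_of_sq_eq_neg {D : ℕ} (hD : Squarefree D) {θ : ℍ[ℚ,α,β]}
    (hθ : θ ^ 2 = -(D : ℍ[ℚ,α,β])) {p : ℕ} [hp : Fact p.Prime] (hpD : p ∣ D) :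
    ‖(nrd θ : ℚ_[p])‖ = (p : ℝ)⁻¹ := by
  have hsq : nrd θ ^ 2 = (D : ℚ) ^ 2 := by
    have h' := congr(nrd $hθ)
    rw [pow_two, nrd_mul, show -(D : ℍ[ℚ,α,β]) = (-D : ℚ) • 1 by
      rw [neg_smul, Nat.cast_smul_eq_nsmul, nsmul_one], nrd_smul, nrd_one] at h'
    linear_combination h'
  obtain ⟨e, rfl⟩ := hpD
  have he : ‖(e : ℚ_[p])‖ = 1 :=
    Padic.norm_natCast_eq_one_iff.2 (Nat.squarefree_mul_iff.1 hD).1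
  rcases sq_eq_sq_iff_eq_or_eq_neg.1 hsq with h' | h' <;> simp [h', he]

variable (hα : α ≠ 0) (hβ : β ≠ 0) (hO : IsMaximalOrder O)
  {φ : K →ₐ[ℚ] ℍ[ℚ,α,β]} (hφ : ∀ a : 𝓞 K, φ a ∈ O) {b : (ℍ[ℚ,α,β])ˣ}
  (hξ : IsInduced s m ξ (conjEmbedding φ b))
include hα hβ hO hξ

theorem not_dvd_conductor {p : ℕ} [hp : Fact p.Prime] (hram : IsRamifiedAt ℍ[ℚ,α,β] p) :
    ¬ p ∣ conductor s O m ξ := by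
  have hle : ‖(nrd (conjEmbedding φ b s) : ℚ_[p])‖ ≤ 1 := by
    rw [h.nrd_map_gen]
    simpa using Padic.norm_int_le_one Δ
  obtain ⟨M, hM, hmem⟩ := hO.exists_coprime_smul_mem hα hβ hram hle
  intro hpc
  exact (Nat.Prime.coprime_iff_not_dvd hp.out).1 hM.symm
    (hpc.trans ((conductor_dvd_iff h hm hξ).2 hmem))

include hφ

theorem localFrobeniusType_eq_pow_factorization {p : ℕ} [hp : Fact p.Prime]
    (hram : IsRamifiedAt ℍ[ℚ,α,β] p) (hinert : (Ideal.span {(p : 𝓞 K)}).IsPrime)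
    {θ : ℍ[ℚ,α,β]} (hθ : ‖(nrd θ : ℚ_[p])‖ = (p : ℝ)⁻¹) {t : ℕ} (ht : t ≠ 0)
    (hN : leftIdealIndex hO.prop φ hφ b = (conductor s O m ξ * t : ℕ)) :
    localFrobeniusType s O θ φ m ξ p = p ^ t.factorization p := by
  classical
  have hpc := not_dvd_conductor h hm hα hβ hO hξ hram
  have hsame : SameReduction O θ φ (conjEmbedding φ b) p ↔ ¬ p ∣ t := by
    rw [sameReduction_iff_norm_nrd_lt_one hα hβ hram hO h
        (h.not_dvd_two_mul_of_inert hp.out hinert) hθ,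
      norm_nrd_sub_conjEmbedding_lt_one_iff hα hβ hram h hinert hO hφ b hN, hp.out.dvd_mul,
      or_iff_right hpc]
  rw [localFrobeniusType_eq_ite h hm hξ]
  by_cases hpt : p ∣ t
  · have h1 : 1 ≤ t.factorization p := (hp.out.dvd_iff_one_le_factorization ht).1 hpt
    have h2 : ¬ 2 ≤ t.factorization p := fun h2 =>
      not_sq_dvd_leftIdealIndex hα hβ hram h hO hφ b hN
        (((hp.out.pow_dvd_iff_le_factorization ht).2 h2).mul_left _)
    rw [if_neg fun hs => hsame.1 hs hpt, show t.factorization p = 1 by lia, pow_one]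
  · rw [if_pos (hsame.2 hpt), Nat.factorization_eq_zero_of_not_dvd hpt, pow_zero]

theorem dvd_discriminant_of_dvd {D : ℕ} (hD : IsDiscriminant ℍ[ℚ,α,β] D) {p t : ℕ}
    [hp : Fact p.Prime] (hN : leftIdealIndex hO.prop φ hφ b = (conductor s O m ξ * t : ℕ))
    (hpt : p ∣ t) : p ∣ D := by
  by_contra hpD
  obtain ⟨t', rfl⟩ := hpt
  refine smul_conjEmbedding_gen_notMem hα hβ hO (mt (hD.2 p).2 hpD) h hφ b
    (M := conductor s O m ξ * t') (by rw [hN]; push_cast; ring) ?_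
  exact (conductor_dvd_iff h hm hξ).1 (dvd_mul_right _ _)

theorem leftIdealIndex_eq_conductor_mul_frobeniusType {D : ℕ} (hD : IsDiscriminant ℍ[ℚ,α,β] D)
    (hinert : ∀ p : ℕ, p.Prime → p ∣ D → (Ideal.span {(p : 𝓞 K)}).IsPrime)
    {θ : ℍ[ℚ,α,β]} (hθ : θ ^ 2 = -(D : ℍ[ℚ,α,β])) :
    leftIdealIndex hO.prop φ hφ b = (conductor s O m ξ * frobeniusType s O θ D φ m ξ : ℕ) := by
  obtain ⟨N, hN0, hN⟩ := exists_natCast_eq_leftIdealIndex hO.prop φ hφ b h.finrank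
  obtain ⟨t, rfl⟩ : conductor s O m ξ ∣ N := by
    rw [conductor_dvd_iff h hm hξ, ← hN]
    exact leftIdealIndex_smul_mem hO.prop φ hφ b h.finrank ⟨s, h.isIntegral_gen⟩
  have ht : t ≠ 0 := by rintro rfl; simp at hN0
  have hsupp : t.factorization.support ⊆ D.primeFactors := fun p hp => by
    have : Fact p.Prime := ⟨Nat.prime_of_mem_primeFactors hp⟩
    exact Nat.mem_primeFactors.2 ⟨this.out, dvd_discriminant_of_dvd h hm hα hβ hO hφ hξ hD hN
      (Nat.dvd_of_mem_primeFactors hp), hD.1.ne_zero⟩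
  have hlocal : frobeniusType s O θ D φ m ξ =
      ∏ p ∈ D.primeFactors.attach, (p : ℕ) ^ t.factorization p := by
    refine Finset.prod_congr rfl fun ⟨p, hp⟩ _ => ?_
    have : Fact p.Prime := ⟨Nat.prime_of_mem_primeFactors hp⟩
    have hpD := Nat.dvd_of_mem_primeFactors hp
    exact localFrobeniusType_eq_pow_factorization h hm hα hβ hO hφ hξ ((hD.2 p).1 hpD)
      (hinert p this.out hpD) (norm_nrd_eq_inv_of_sq_eq_neg hD.1 hθ hpD) ht hN
  rw [hN, hlocal, Finset.prod_attach D.primeFactors fun p => p ^ t.factorization p,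
    ← Finsupp.prod_of_support_subset _ hsupp _ fun p _ => pow_zero p,
    Nat.prod_factorization_pow_eq_self ht]

end IndexFormula

section ClassRepresentatives

variable {K : Type*} [Field K] [NumberField K]

theorem classGroup_mk_eq_iff {I J : (FractionalIdeal (𝓞 K)⁰ K)ˣ} :
    ClassGroup.mk (R := 𝓞 K) K I = ClassGroup.mk K J ↔
      ∃ x : Kˣ, (I : FractionalIdeal (𝓞 K)⁰ K) * FractionalIdeal.spanSingleton (𝓞 K)⁰ (x : K) =
        J := by
  have hIJ : ClassGroup.mk (R := 𝓞 K) K I = ClassGroup.mk K J ↔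
      ∃ x : K, (J / I : FractionalIdeal (𝓞 K)⁰ K) = FractionalIdeal.spanSingleton (𝓞 K)⁰ x := by
    rw [eq_comm, ← div_eq_one, ← map_div, ClassGroup.mk_eq_one_iff,
      FractionalIdeal.isPrincipal_iff, Units.val_div_eq_div_val]
  rw [hIJ]
  constructor
  · rintro ⟨x, hx⟩
    have hx0 : x ≠ 0 := by
      rintro rfl
      exact div_ne_zero J.ne_zero I.ne_zero (by rw [hx, FractionalIdeal.spanSingleton_zero])
    exact ⟨Units.mk0 x hx0, by rw [Units.val_mk0, ← hx, mul_div_cancel₀ _ I.ne_zero]⟩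
  · rintro ⟨x, hx⟩
    exact ⟨x, by rw [← hx, mul_div_cancel_left₀ _ I.ne_zero]⟩

theorem spanSingleton_unit_mul (u : (𝓞 K)ˣ) (x : K) :
    FractionalIdeal.spanSingleton (𝓞 K)⁰ (((u : 𝓞 K) : K) * x) =
      FractionalIdeal.spanSingleton (𝓞 K)⁰ x :=
  (FractionalIdeal.spanSingleton_eq_spanSingleton.2
    ⟨u, by rw [Units.smul_def, Algebra.smul_def]⟩).symm

variable {ι : Type*} {𝔞 : ι → (FractionalIdeal (𝓞 K)⁰ K)ˣ}

theorem exists_mul_spanSingleton_eq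
    (h𝔞 : Function.Surjective fun i => ClassGroup.mk (R := 𝓞 K) K (𝔞 i))
    {L : FractionalIdeal (𝓞 K)⁰ K} (hL : L ≠ 0) :
    ∃ x : ι × Kˣ, (𝔞 x.1 : FractionalIdeal (𝓞 K)⁰ K) *
      FractionalIdeal.spanSingleton (𝓞 K)⁰ (x.2 : K) = L := by
  obtain ⟨i, hi⟩ := h𝔞 (ClassGroup.mk K (Units.mk0 L hL))
  obtain ⟨x, hx⟩ := classGroup_mk_eq_iff.1 hi
  exact ⟨(i, x), hx⟩

theorem eq_and_exists_unit_of_mul_spanSingleton_eq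
    (h𝔞 : Function.Injective fun i => ClassGroup.mk (R := 𝓞 K) K (𝔞 i)) {i j : ι} {x y : Kˣ}
    (hxy : (𝔞 i : FractionalIdeal (𝓞 K)⁰ K) * FractionalIdeal.spanSingleton (𝓞 K)⁰ (x : K) =
      𝔞 j * FractionalIdeal.spanSingleton (𝓞 K)⁰ (y : K)) :
    i = j ∧ ∃ u : (𝓞 K)ˣ, ((u : 𝓞 K) : K) * x = y := by
  have hij : i = j := by
    refine h𝔞 (classGroup_mk_eq_iff.2 ⟨x / y, ?_⟩)
    rw [Units.val_div_eq_div_val, div_eq_mul_inv,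
      ← FractionalIdeal.spanSingleton_mul_spanSingleton, ← mul_assoc, hxy, mul_assoc,
      FractionalIdeal.spanSingleton_mul_spanSingleton, mul_inv_cancel₀ y.ne_zero,
      FractionalIdeal.spanSingleton_one, mul_one]
  subst hij
  obtain ⟨u, hu⟩ := FractionalIdeal.spanSingleton_eq_spanSingleton.1
    (mul_left_cancel₀ (𝔞 i).ne_zero hxy)
  exact ⟨rfl, u, by rw [← hu, Units.smul_def, Algebra.smul_def]⟩

theorem exists_ideal_of_le {I L : FractionalIdeal (𝓞 K)⁰ K} (hI : I ≠ 0) (hL : L ≤ I) :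
    ∃ J : Ideal (𝓞 K), L = I * J := by
  have hle : I⁻¹ * L ≤ 1 := by
    rw [← inv_mul_cancel₀ hI]
    exact mul_le_mul_right hL _
  obtain ⟨J, hJ⟩ := FractionalIdeal.le_one_iff_exists_coeIdeal.1 hle
  exact ⟨J, by rw [hJ, mul_inv_cancel_left₀ hI]⟩

/-- The pairs `(i, x)` such that `x 𝔞ᵢ = I J` for an integral ideal `J` of norm `r`. -/
def IdealMultiples (𝔞 : ι → (FractionalIdeal (𝓞 K)⁰ K)ˣ) (I : FractionalIdeal (𝓞 K)⁰ K) (r : ℚ) :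
    Set (ι × K) :=
  {x | ∃ J : Ideal (𝓞 K), (Ideal.absNorm J : ℚ) = r ∧
    (𝔞 x.1 : FractionalIdeal (𝓞 K)⁰ K) * FractionalIdeal.spanSingleton (𝓞 K)⁰ x.2 = I * J}

variable {I : FractionalIdeal (𝓞 K)⁰ K} (hI : I ≠ 0) {r : ℚ}
include hI

theorem mem_idealMultiples_iff {i : ι} {x : K} :
    (i, x) ∈ IdealMultiples 𝔞 I r ↔
      (𝔞 i : FractionalIdeal (𝓞 K)⁰ K) * FractionalIdeal.spanSingleton (𝓞 K)⁰ x ≤ I ∧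
        FractionalIdeal.absNorm (𝔞 i : FractionalIdeal (𝓞 K)⁰ K) * |Algebra.norm ℚ x| =
          FractionalIdeal.absNorm I * r := by
  rw [← FractionalIdeal.absNorm_span_singleton (R := 𝓞 K), ← map_mul]
  constructor
  · rintro ⟨J, hJr, hJ⟩
    rw [hJ, map_mul, FractionalIdeal.coeIdeal_absNorm, hJr]
    exact ⟨(mul_le_mul_right FractionalIdeal.coeIdeal_le_one I).trans_eq (mul_one I), rfl⟩
  · rintro ⟨hle, hnorm⟩
    obtain ⟨J, hJ⟩ := exists_ideal_of_le hI hle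
    rw [hJ, map_mul, FractionalIdeal.coeIdeal_absNorm] at hnorm
    exact ⟨J, mul_left_cancel₀ (absNorm_pos hI).ne' hnorm, hJ⟩

theorem ne_zero_of_mem_idealMultiples (hr : r ≠ 0) {x : ι × K} (hx : x ∈ IdealMultiples 𝔞 I r) :
    x.2 ≠ 0 := by
  intro h0
  have hnorm := ((mem_idealMultiples_iff hI).1 hx).2
  rw [h0, Algebra.norm_zero, abs_zero, mul_zero, zero_eq_mul] at hnorm
  exact hnorm.elim (absNorm_pos hI).ne' hr

theorem nonempty_equiv_idealMultiples
    (h𝔞 : Function.Bijective fun i => ClassGroup.mk (R := 𝓞 K) K (𝔞 i)) (hr : r ≠ 0) :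
    Nonempty ((𝓞 K)ˣ × {J : Ideal (𝓞 K) // (Ideal.absNorm J : ℚ) = r} ≃
      IdealMultiples 𝔞 I r) := by
  have hgen (J : {J : Ideal (𝓞 K) // (Ideal.absNorm J : ℚ) = r}) : ∃ x : ι × Kˣ,
      (𝔞 x.1 : FractionalIdeal (𝓞 K)⁰ K) * FractionalIdeal.spanSingleton (𝓞 K)⁰ (x.2 : K) =
        I * (J : Ideal (𝓞 K)) := by
    refine exists_mul_spanSingleton_eq h𝔞.2
      (mul_ne_zero hI (FractionalIdeal.coeIdeal_ne_zero.2 fun h0 => hr ?_))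
    rw [← J.2, h0, Ideal.absNorm_bot, Nat.cast_zero]
  choose F hF using hgen
  refine ⟨Equiv.ofBijective (fun uJ => ⟨((F uJ.2).1, ((uJ.1 : 𝓞 K) : K) * (F uJ.2).2),
    uJ.2, uJ.2.2, by rw [spanSingleton_unit_mul, hF]⟩) ⟨?_, ?_⟩⟩
  · rintro ⟨u, J⟩ ⟨v, J'⟩ huv
    obtain ⟨hi, hx⟩ := Prod.mk.inj (Subtype.ext_iff.1 huv)
    obtain rfl : J = J' := by
      refine Subtype.ext (FractionalIdeal.coeIdeal_injective (mul_left_cancel₀ hI ?_))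
      rw [← hF, ← hF, ← spanSingleton_unit_mul u, ← spanSingleton_unit_mul v (F J').2]
      exact congr((𝔞 $(hi)) * FractionalIdeal.spanSingleton (𝓞 K)⁰ $(hx))
    rw [Prod.mk.injEq]
    exact ⟨Units.ext (NumberField.RingOfIntegers.coe_injective
      (mul_right_cancel₀ (F J).2.ne_zero hx)), rfl⟩
  · rintro ⟨⟨i, x⟩, hx⟩
    have hx0 := ne_zero_of_mem_idealMultiples hI hr hx
    obtain ⟨J, hJr, hJ⟩ := hx
    obtain ⟨hi, u, hu⟩ := eq_and_exists_unit_of_mul_spanSingleton_eq h𝔞.1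
      (y := Units.mk0 x hx0) ((hF ⟨J, hJr⟩).trans hJ.symm)
    exact ⟨(u, ⟨J, hJr⟩), Subtype.ext (Prod.ext hi hu)⟩

theorem encard_idealMultiples [Finite (𝓞 K)ˣ]
    (h𝔞 : Function.Bijective fun i => ClassGroup.mk (R := 𝓞 K) K (𝔞 i)) (hr : r ≠ 0) :
    (IdealMultiples 𝔞 I r).encard = (Nat.card (𝓞 K)ˣ * rho K r : ℕ) := by
  obtain ⟨e⟩ := nonempty_equiv_idealMultiples hI h𝔞 hr
  have hfin : Finite {J : Ideal (𝓞 K) // (Ideal.absNorm J : ℚ) = r} := by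
    rcases isEmpty_or_nonempty {J : Ideal (𝓞 K) // (Ideal.absNorm J : ℚ) = r} with h0 | ⟨J, rfl⟩
    · infer_instance
    · refine Set.Finite.to_subtype (s := {L | (Ideal.absNorm L : ℚ) = Ideal.absNorm J}) ?_
      simpa only [Nat.cast_inj] using Ideal.finite_setOfPred_absNorm_eq (S := 𝓞 K) (Ideal.absNorm J)
  rw [← ENat.card_coe_set_eq, ← ENat.card_congr e, ENat.card_eq_coe_natCard, Nat.card_prod, rho]

end ClassRepresentatives

section Fibres

variable {α β : ℚ} {K : Type*} [Field K] [NumberField K] {Δ : ℤ} {s : K}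

theorem mem_idealLattice_iff {O : Subring ℍ[ℚ,α,β]} {φ : K →ₐ[ℚ] ℍ[ℚ,α,β]}
    (hφ : ∀ a : 𝓞 K, φ a ∈ O) (𝔞 : (FractionalIdeal (𝓞 K)⁰ K)ˣ) {y : ℍ[ℚ,α,β]} :
    y ∈ idealLattice O φ 𝔞 ↔ ∀ x ∈ (𝔞 : FractionalIdeal (𝓞 K)⁰ K), φ x * y ∈ O := by
  constructor
  · intro hy x hx
    induction hy using AddSubgroup.closure_induction with
    | mem y hy =>
      obtain ⟨z, hz, b, hb, rfl⟩ := hy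
      obtain ⟨a, ha⟩ : ∃ a : 𝓞 K, algebraMap (𝓞 K) K a = x * z := by
        rw [← FractionalIdeal.mem_one_iff (𝓞 K)⁰, ← Units.mul_inv 𝔞]
        exact FractionalIdeal.mul_mem_mul hx hz
      rw [← mul_assoc, ← map_mul, ← ha]
      exact mul_mem (hφ a) hb
    | zero => rw [mul_zero]; exact O.zero_mem
    | add y z _ _ hy hz => rw [mul_add]; exact add_mem hy hz
    | neg y _ hy => rw [mul_neg]; exact neg_mem hy
  · intro hy
    suffices ∀ z ∈ ((𝔞⁻¹ : (FractionalIdeal (𝓞 K)⁰ K)ˣ) : FractionalIdeal (𝓞 K)⁰ K) * 𝔞,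
        φ z * y ∈ idealLattice O φ 𝔞 by
      simpa using this 1 (by rw [Units.inv_mul]; exact FractionalIdeal.one_mem_one _)
    intro z hz
    refine FractionalIdeal.mul_induction_on hz (fun k hk l hl => ?_) fun x y hx hy => ?_
    · exact AddSubgroup.subset_closure ⟨k, hk, φ l * y, hy l hl, by rw [map_mul, mul_assoc]⟩
    · rw [map_add, add_mul]; exact add_mem hx hy

theorem map_mul_mem_idealLattice_iff {O : Subring ℍ[ℚ,α,β]} (hO : IsOrder O)
    (φ : K →ₐ[ℚ] ℍ[ℚ,α,β]) (hφ : ∀ a : 𝓞 K, φ a ∈ O) (b : (ℍ[ℚ,α,β])ˣ)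
    (𝔞 : (FractionalIdeal (𝓞 K)⁰ K)ˣ) (x : K) :
    φ x * (b : ℍ[ℚ,α,β]) ∈ idealLattice O φ 𝔞 ↔
      (𝔞 : FractionalIdeal (𝓞 K)⁰ K) * FractionalIdeal.spanSingleton (𝓞 K)⁰ x ≤
        leftIdeal hO φ hφ b := by
  rw [mem_idealLattice_iff hφ, mul_comm, FractionalIdeal.spanSingleton_mul_le_iff]
  refine forall₂_congr fun z _ => ?_
  rw [mem_leftIdeal, mul_comm x, map_mul, mul_assoc]

theorem exists_eq_smul_add_smul_of_commute {t z : ℍ[ℚ,α,β]} (ht : trd t = 0) (ht0 : nrd t ≠ 0)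
    (hz : Commute z t) : ∃ u v : ℚ, z = u • 1 + v • t := by
  have hstar {y : ℍ[ℚ,α,β]} : star y = trd y • 1 - y := star_eq_trd_sub y
  -- Expand `star (z * t) = star t * star z`.
  have h2zt : (2 : ℚ) • (z * t) = trd (z * t) • 1 + trd z • t := by
    have h := star_mul z t
    rw [hstar, hstar, hstar, ht, zero_smul, zero_sub, neg_mul, mul_sub, ← hz.eq, mul_smul_comm,
      mul_one] at h
    linear_combination (norm := module) -h
  have htt : t * t = -nrd t • 1 := by
    have h := mul_self_eq t
    rw [ht] at h
    linear_combination (norm := module) h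
  have h2z := congr($h2zt * t)
  rw [smul_mul_assoc, mul_assoc, htt, add_mul, smul_mul_assoc, smul_mul_assoc, htt, mul_smul_comm,
    mul_one, one_mul] at h2z
  refine ⟨trd z / 2, -trd (z * t) / (2 * nrd t), ?_⟩
  refine smul_right_injective _ (mul_ne_zero two_ne_zero ht0) ?_
  simp only [smul_add, smul_smul, mul_div_cancel₀ _ (mul_ne_zero two_ne_zero ht0)]
  linear_combination (norm := module) -h2z

theorem conjMap_coe (φ : K →ₐ[ℚ] ℍ[ℚ,α,β]) (m : ℕ) (b : (ℍ[ℚ,α,β])ˣ) :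
    conjMap s φ m b = conjEmbedding φ b (m * s) := by
  rw [conjMap, Ring.inverse_unit, map_natCast_mul_eq_smul, conjEmbedding_apply,
    Nat.cast_smul_eq_nsmul, nsmul_eq_mul]

theorem quadForm_map_mul (hK : Module.finrank ℚ K = 2) (φ : K →ₐ[ℚ] ℍ[ℚ,α,β]) (x : K)
    (y : ℍ[ℚ,α,β]) : quadForm Δ (φ x * y) = Algebra.norm ℚ x * quadForm Δ y := by
  rw [quadForm, quadForm, nrd_mul, (trd_map_and_nrd_map hK φ x).2, mul_left_comm]

namespace IsImaginaryQuadratic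

variable (h : IsImaginaryQuadratic Δ s)
include h

theorem norm_nonneg (x : K) : 0 ≤ Algebra.norm ℚ x := by
  obtain ⟨u, v, rfl⟩ := h.exists_coords x
  rw [h.norm_coords]
  nlinarith [h.neg_rat, pow_two_nonneg u, pow_two_nonneg v]

variable (φ : K →ₐ[ℚ] ℍ[ℚ,α,β])

theorem conjEmbedding_gen_eq_iff {b c : (ℍ[ℚ,α,β])ˣ} :
    conjEmbedding φ c s = conjEmbedding φ b s ↔ ∃ x : K, (c : ℍ[ℚ,α,β]) = φ x * b := by
  refine ⟨fun hcb => ?_, fun ⟨x, hx⟩ => by rw [conjEmbedding_eq_of_eq_map_mul φ hx]⟩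
  have hcomm : Commute (c * ↑b⁻¹ : ℍ[ℚ,α,β]) (φ s) := by
    have hcb' := congr(c * $hcb * ↑b⁻¹)
    simp only [conjEmbedding_apply, mul_assoc, Units.mul_inv_cancel_left, Units.mul_inv,
      mul_one] at hcb'
    rw [commute_iff_eq, mul_assoc, hcb']
  have hnrd : nrd (φ s) ≠ 0 := by
    rw [h.nrd_map_gen]
    exact neg_ne_zero.2 h.neg_rat.ne
  obtain ⟨u, v, huv⟩ := exists_eq_smul_add_smul_of_commute (h.trd_map_gen φ) hnrd hcomm
  refine ⟨u • 1 + v • s, ?_⟩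
  rw [map_add, map_smul, map_smul, map_one, ← huv, Units.inv_mul_cancel_right]

variable {O : Subring ℍ[ℚ,α,β]} (hO : IsOrder O) (hφ : ∀ a : 𝓞 K, φ a ∈ O)

theorem map_mul_mem_and_abs_quadForm_iff {m : ℕ} {ι : Type*}
    {𝔞 : ι → (FractionalIdeal (𝓞 K)⁰ K)ˣ} (b : (ℍ[ℚ,α,β])ˣ) {i : ι} {x : K} :
    (φ x * (b : ℍ[ℚ,α,β]) ∈ idealLattice O φ (𝔞 i) ∧ |quadForm Δ (φ x * (b : ℍ[ℚ,α,β]))| =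
        m / FractionalIdeal.absNorm (𝔞 i : FractionalIdeal (𝓞 K)⁰ K)) ↔
      (i, x) ∈ IdealMultiples 𝔞 (leftIdeal hO φ hφ b) (m / (leftIdealIndex hO φ hφ b * |Δ|)) := by
  have hI := leftIdeal_ne_zero hO φ hφ b
  have hI0 := (absNorm_pos hI).ne'
  have hb0 := (abs_pos.2 (nrd_unit_ne_zero b)).ne'
  have hΔ0 : |(Δ : ℚ)| ≠ 0 := abs_ne_zero.2 h.neg_rat.ne
  rw [mem_idealMultiples_iff hI, map_mul_mem_idealLattice_iff hO φ hφ, and_congr_right_iff]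
  intro _
  rw [quadForm_map_mul h.finrank, abs_mul, quadForm, abs_mul,
    eq_div_iff (absNorm_pos (𝔞 i).ne_zero).ne', leftIdealIndex, Int.cast_abs]
  field_simp

end IsImaginaryQuadratic

end Fibres

section CycleCount

theorem encard_sigma_eq_encard_prod {ι M : Type*} {X : ι → Set M} (P : M → Prop) :
    Set.encard {x : Σ i, X i | P x.2} = Set.encard {x : ι × M | x.2 ∈ X x.1 ∧ P x.2} := by
  let f : (Σ i, X i) → ι × M := fun x => (x.1, x.2)
  have hf : Function.Injective f := by
    rintro ⟨i, y, hy⟩ ⟨j, z, hz⟩ hyz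
    obtain ⟨rfl, rfl⟩ := Prod.mk.inj hyz
    rfl
  rw [← hf.encard_image]
  congr 1
  ext ⟨i, y⟩
  constructor
  · rintro ⟨⟨j, z, hz⟩, hP, hjz⟩
    obtain ⟨rfl, rfl⟩ := Prod.mk.inj hjz
    exact ⟨hz, hP⟩
  · exact fun ⟨hy, hP⟩ => ⟨⟨i, y, hy⟩, hP, rfl⟩

theorem eq_mul_iff_abs_eq_and_mul_pos {R : Type*} [CommRing R] [LinearOrder R]
    [IsStrictOrderedRing R] {ε a c : R} (hε : |ε| = 1) (hc : 0 < c) :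
    a = ε * c ↔ |a| = c ∧ 0 < ε * a := by
  have hεε : ε * ε = 1 := by rw [← abs_mul_abs_self, hε, one_mul]
  constructor
  · rintro rfl
    rw [abs_mul, hε, one_mul, abs_of_pos hc, ← mul_assoc, hεε, one_mul]
    exact ⟨rfl, hc⟩
  · rintro ⟨rfl, hpos⟩
    rw [← one_mul |a|, ← hε, ← abs_mul, abs_of_pos hpos, ← mul_assoc, hεε, one_mul]

variable {α β : ℚ} {K : Type*} [Field K] [NumberField K] {Δ : ℤ} {s : K}
  (h : IsImaginaryQuadratic Δ s) {O : Subring ℍ[ℚ,α,β]} (φ : K →ₐ[ℚ] ℍ[ℚ,α,β])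
  (hφ : ∀ a : 𝓞 K, φ a ∈ O) {m : ℕ} (hm : 0 < m) {ι : Type*}
  {𝔞 : ι → (FractionalIdeal (𝓞 K)⁰ K)ˣ} {ε : ℚ} (hε : |ε| = 1) {X : ι → Set ℍ[ℚ,α,β]}
  (hX : ∀ i y, y ∈ X i ↔ y ∈ idealLattice O φ (𝔞 i) ∧
    quadForm Δ y = ε * (m / FractionalIdeal.absNorm (𝔞 i : FractionalIdeal (𝓞 K)⁰ K)))
include h hφ hm hε hX

omit h hφ in
theorem mem_iff_abs_quadForm {i : ι} {y : ℍ[ℚ,α,β]} :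
    y ∈ X i ↔ (y ∈ idealLattice O φ (𝔞 i) ∧
      |quadForm Δ y| = m / FractionalIdeal.absNorm (𝔞 i : FractionalIdeal (𝓞 K)⁰ K)) ∧
        0 < ε * quadForm Δ y := by
  rw [hX, eq_mul_iff_abs_eq_and_mul_pos hε
    (div_pos (by exact_mod_cast hm) (absNorm_pos (𝔞 i).ne_zero)), and_assoc]

omit h hφ in
theorem isUnit_of_mem {i : ι} {y : ℍ[ℚ,α,β]} (hy : y ∈ X i) : IsUnit y :=
  isUnit_of_nrd_ne_zero (right_ne_zero_of_mul
    (right_ne_zero_of_mul ((mem_iff_abs_quadForm φ hm hε hX).1 hy).2.ne'))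

theorem conjMap_mem_omegaO (hO : IsOrder O) {i : ι} {y : ℍ[ℚ,α,β]} (hy : y ∈ X i) :
    conjMap s φ m y ∈ OmegaO O (|Δ| * m ^ 2) := by
  obtain ⟨c, rfl⟩ := isUnit_of_mem φ hm hε hX hy
  obtain ⟨J, hJ, -⟩ := (h.map_mul_mem_and_abs_quadForm_iff φ hO hφ c (i := i) (x := 1)).1
    (by rw [map_one, one_mul]; exact ((mem_iff_abs_quadForm φ hm hε hX).1 hy).1)
  have hm' : (m : ℚ) = ((|Δ| * Ideal.absNorm J : ℤ) : ℚ) * leftIdealIndex hO φ hφ c := by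
    have hΔ : ((|Δ| : ℤ) : ℚ) ≠ 0 := by exact_mod_cast abs_ne_zero.2 h.neg.ne
    rw [eq_div_iff (mul_ne_zero (leftIdealIndex_pos hO φ hφ c).ne' hΔ)] at hJ
    rw [← hJ]
    push_cast
    ring
  rw [conjMap_coe, map_natCast_mul_eq_smul]
  refine ⟨?_, ?_, ?_⟩
  · rw [hm', mul_smul]
    exact intCast_smul_mem _ (leftIdealIndex_smul_mem hO φ hφ c h.finrank ⟨s, h.isIntegral_gen⟩)
  · rw [trd_smul, h.trd_map_gen, mul_zero]
  · rw [nrd_smul, h.nrd_map_gen, Int.cast_abs, abs_of_neg h.neg_rat, mul_comm]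

theorem map_mul_mem_iff_mem_idealMultiples (hO : IsOrder O) {b : (ℍ[ℚ,α,β])ˣ}
    (hb : 0 < ε * quadForm Δ (b : ℍ[ℚ,α,β])) {i : ι} {x : K} :
    φ x * (b : ℍ[ℚ,α,β]) ∈ X i ↔
      (i, x) ∈ IdealMultiples 𝔞 (leftIdeal hO φ hφ b) (m / (leftIdealIndex hO φ hφ b * |Δ|)) := by
  rw [← h.map_mul_mem_and_abs_quadForm_iff φ hO hφ b, mem_iff_abs_quadForm φ hm hε hX,
    and_iff_left_iff_imp]
  rintro ⟨-, hx⟩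
  have hx0 : Algebra.norm ℚ x ≠ 0 := by
    intro hx0
    rw [quadForm_map_mul h.finrank, hx0, zero_mul, abs_zero] at hx
    exact (div_pos (Nat.cast_pos.2 hm) (absNorm_pos (𝔞 i).ne_zero)).ne hx
  rw [quadForm_map_mul h.finrank, mul_left_comm]
  exact mul_pos ((h.norm_nonneg x).lt_of_ne' hx0) hb

omit hφ in
theorem conjMap_eq_iff_of_mem {i : ι} {y : ℍ[ℚ,α,β]} (hy : y ∈ X i) {b : (ℍ[ℚ,α,β])ˣ} :
    conjMap s φ m y = conjEmbedding φ b (m * s) ↔ ∃ x : K, φ x * b = y := by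
  obtain ⟨c, rfl⟩ := isUnit_of_mem φ hm hε hX hy
  rw [conjMap_coe, map_natCast_mul_eq_smul, map_natCast_mul_eq_smul,
    smul_right_inj (by positivity : (m : ℚ) ≠ 0), h.conjEmbedding_gen_eq_iff]
  simp only [eq_comm]

theorem encard_fibre (hO : IsOrder O)
    (h𝔞 : Function.Bijective fun i => ClassGroup.mk (R := 𝓞 K) K (𝔞 i)) {b : (ℍ[ℚ,α,β])ˣ}
    (hb : 0 < ε * quadForm Δ (b : ℍ[ℚ,α,β])) :
    Set.encard {x : Σ i, X i | conjMap s φ m (x.2 : ℍ[ℚ,α,β]) = conjEmbedding φ b (m * s)} =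
      (Nat.card (𝓞 K)ˣ * rho K (m / (leftIdealIndex hO φ hφ b * |Δ|)) : ℕ) := by
  have := h.finite_units
  have hr : (m : ℚ) / (leftIdealIndex hO φ hφ b * (|Δ| : ℤ)) ≠ 0 :=
    div_ne_zero (by positivity) (mul_ne_zero (leftIdealIndex_pos hO φ hφ b).ne'
      (by exact_mod_cast abs_ne_zero.2 h.neg.ne))
  let g : ι × K → ι × ℍ[ℚ,α,β] := Prod.map id fun x => φ x * b
  have hg : Function.Injective g := Function.injective_id.prodMap fun x y hxy =>
    φ.toRingHom.injective ((Units.mul_left_inj b).1 hxy)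
  rw [encard_sigma_eq_encard_prod fun y => conjMap s φ m y = conjEmbedding φ b (m * s),
    ← encard_idealMultiples (leftIdeal_ne_zero hO φ hφ b) h𝔞 hr, ← hg.encard_image]
  congr 1
  ext ⟨i, y⟩
  constructor
  · rintro ⟨hy, hyb⟩
    obtain ⟨x, rfl⟩ := (conjMap_eq_iff_of_mem h φ hm hε hX hy).1 hyb
    exact ⟨(i, x), (map_mul_mem_iff_mem_idealMultiples h φ hφ hm hε hX hO hb).1 hy, rfl⟩
  · rintro ⟨⟨j, x⟩, hx, hxy⟩
    obtain ⟨rfl, rfl⟩ := Prod.mk.inj hxy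
    have hy := (map_mul_mem_iff_mem_idealMultiples h φ hφ hm hε hX hO hb).2 hx
    exact ⟨hy, (conjMap_eq_iff_of_mem h φ hm hε hX hy).2 ⟨x, rfl⟩⟩

theorem conjMap_mem_and_encard_fibre (hα : α ≠ 0) (hβ : β ≠ 0) {D : ℕ}
    (hD : IsDiscriminant ℍ[ℚ,α,β] D)
    (hinert : ∀ p : ℕ, p.Prime → p ∣ D → (Ideal.span {(p : 𝓞 K)}).IsPrime)
    (hO : IsMaximalOrder O) {θ : ℍ[ℚ,α,β]} (hθ : θ ^ 2 = -(D : ℍ[ℚ,α,β]))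
    (h𝔞 : Function.Bijective fun i => ClassGroup.mk (R := 𝓞 K) K (𝔞 i)) {Y : Set ℍ[ℚ,α,β]}
    (hY : ∀ ξ, ξ ∈ Y ↔ ξ ∈ OmegaO O (|Δ| * m ^ 2) ∧ ∃ b : (ℍ[ℚ,α,β])ˣ,
      0 < ε * quadForm Δ (b : ℍ[ℚ,α,β]) ∧ ξ = m * (↑b⁻¹ * φ s * b)) :
    (∀ i, ∀ η ∈ X i, IsUnit η ∧ conjMap s φ m η ∈ Y) ∧
      ∀ ξ ∈ Y, Set.encard {x : Σ i, X i | conjMap s φ m (x.2 : ℍ[ℚ,α,β]) = ξ} =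
        (Nat.card (𝓞 K)ˣ * rho K
          (m / (conductor s O m ξ * frobeniusType s O θ D φ m ξ * |Δ|)) : ℕ) := by
  have hconj (b : (ℍ[ℚ,α,β])ˣ) : m * (↑b⁻¹ * φ s * b) = conjMap s φ m (b : ℍ[ℚ,α,β]) := by
    rw [conjMap, Ring.inverse_unit]
  refine ⟨fun i η hη => ?_, fun ξ hξ => ?_⟩
  · have hmem := conjMap_mem_omegaO h φ hφ hm hε hX hO.prop hη
    have hpos := ((mem_iff_abs_quadForm φ hm hε hX).1 hη).2
    obtain ⟨c, rfl⟩ := isUnit_of_mem φ hm hε hX hη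
    exact ⟨c.isUnit, (hY _).2 ⟨hmem, c, hpos, (hconj c).symm⟩⟩
  · obtain ⟨-, b, hb, rfl⟩ := (hY ξ).1 hξ
    rw [hconj, conjMap_coe, encard_fibre h φ hφ hm hε hX hO.prop h𝔞 hb,
      leftIdealIndex_eq_conductor_mul_frobeniusType h hm hα hβ hO hφ rfl hD hinert hθ,
      Nat.cast_mul (conductor s O m _)]

end CycleCount

end QuatCycles

theorem mainTheorem4_general {K : Type*} [Field K] [NumberField K]
    (Δ : ℤ) (hΔneg : Δ < 0) (hΔsq : Squarefree Δ) (hΔ4 : Δ % 4 ≠ 1)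
    (s : K) (hs : s ^ 2 = (Δ : K)) (hK : Module.finrank ℚ K = 2)
    (α β : ℚ) (hα : α ≠ 0) (hβ : β ≠ 0)
    (D : ℕ) (hD : QuatCycles.IsDiscriminant ℍ[ℚ,α,β] D)
    (hinert : ∀ p : ℕ, p.Prime → p ∣ D → (Ideal.span {(p : 𝓞 K)}).IsPrime)
    (O : Subring ℍ[ℚ,α,β]) (hO : QuatCycles.IsMaximalOrder O)
    (θ : ℍ[ℚ,α,β]) (hθ : θ ^ 2 = -(D : ℍ[ℚ,α,β]))
    (φ : K →ₐ[ℚ] ℍ[ℚ,α,β]) (hφ : ∀ a : 𝓞 K, φ a ∈ O) (m : ℕ) (hm : 0 < m)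
    {ι : Type*} (𝔞 : ι → (FractionalIdeal (𝓞 K)⁰ K)ˣ)
    (h𝔞 : Function.Bijective fun i => ClassGroup.mk (R := 𝓞 K) K (𝔞 i)) :
    ((∀ i, ∀ η ∈ QuatCycles.OmegaPlus Δ O φ m (𝔞 i),
        IsUnit η ∧ QuatCycles.conjMap s φ m η ∈ QuatCycles.OmegaPos Δ s O φ m) ∧
      ∀ ξ ∈ QuatCycles.OmegaPos Δ s O φ m,
        Set.encard {x : Σ i, QuatCycles.OmegaPlus Δ O φ m (𝔞 i) |
            QuatCycles.conjMap s φ m (x.2 : ℍ[ℚ,α,β]) = ξ} =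
          (Nat.card (𝓞 K)ˣ * QuatCycles.rho K
            (m / (QuatCycles.conductor s O m ξ * QuatCycles.frobeniusType s O θ D φ m ξ * |Δ|)) :
              ℕ)) ∧
    ((∀ i, ∀ η ∈ QuatCycles.OmegaMinus Δ O φ m (𝔞 i),
        IsUnit η ∧ QuatCycles.conjMap s φ m η ∈ QuatCycles.OmegaNeg Δ s O φ m) ∧
      ∀ ξ ∈ QuatCycles.OmegaNeg Δ s O φ m,
        Set.encard {x : Σ i, QuatCycles.OmegaMinus Δ O φ m (𝔞 i) |
            QuatCycles.conjMap s φ m (x.2 : ℍ[ℚ,α,β]) = ξ} =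
          (Nat.card (𝓞 K)ˣ * QuatCycles.rho K
            (m / (QuatCycles.conductor s O m ξ * QuatCycles.frobeniusType s O θ D φ m ξ * |Δ|)) :
              ℕ)) := by
  have h : QuatCycles.IsImaginaryQuadratic Δ s := ⟨hΔneg, hΔsq, hΔ4, hs, hK⟩
  constructor
  · refine QuatCycles.conjMap_mem_and_encard_fibre h φ hφ hm (𝔞 := 𝔞) (ε := 1) abs_one
      (fun i y => ?_) hα hβ hD hinert hO hθ h𝔞 fun ξ => ?_
    · rw [one_mul]; rfl
    · simp only [one_mul]; rfl
  · refine QuatCycles.conjMap_mem_and_encard_fibre h φ hφ hm (𝔞 := 𝔞) (ε := -1) (by simp)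
      (fun i y => ?_) hα hβ hD hinert hO hθ h𝔞 fun ξ => ?_
    · rw [neg_one_mul]; rfl
    · simp only [neg_one_mul, neg_pos]; rfl

theorem mainTheorem4
    -- the imaginary quadratic field `k = ℚ(√Δ)`
    {K : Type*} [Field K] [NumberField K]
    (Δ : ℤ) (hΔneg : Δ < 0) (hΔsq : Squarefree Δ) (hΔeven : Even Δ)
    (s : K) (hs : s ^ 2 = (Δ : K)) (hK : Module.finrank ℚ K = 2)
    -- the indefinite quaternion algebra `B`, of discriminant `D > 1`
    (α β : ℚ) (hα : α ≠ 0) (hβ : β ≠ 0)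
    (hB : QuatCycles.IsIndefinite ℍ[ℚ, α, β])
    (D : ℕ) (hD : QuatCycles.IsDiscriminant ℍ[ℚ, α, β] D) (hD1 : 1 < D)
    (hinert : ∀ p : ℕ, p.Prime → p ∣ D → (Ideal.span {(p : 𝓞 K)}).IsPrime)
    -- a maximal order, `θ` in it, and an embedding `φ : o_k → O_B`
    (O : Subring ℍ[ℚ, α, β]) (hO : QuatCycles.IsMaximalOrder O)
    (θ : ℍ[ℚ, α, β]) (hθO : θ ∈ O) (hθ : θ ^ 2 = -(D : ℍ[ℚ, α, β]))
    (φ : K →ₐ[ℚ] ℍ[ℚ, α, β]) (hφ : ∀ a : 𝓞 K, φ a ∈ O)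
    (m : ℕ) (hm : 0 < m)
    -- representatives of the ideal classes
    {h : ℕ} (𝔞 : Fin h → (FractionalIdeal (𝓞 K)⁰ K)ˣ)
    (h𝔞 : Function.Bijective (fun i => (ClassGroup.mk (R := 𝓞 K) (K := K) (𝔞 i) : ClassGroup (𝓞 K)))) :
    ((∀ (i : Fin h), ∀ η ∈ QuatCycles.OmegaPlus Δ O φ m (𝔞 i),
        IsUnit η ∧ QuatCycles.conjMap s φ m η ∈ QuatCycles.OmegaPos Δ s O φ m) ∧
      ∀ ξ ∈ QuatCycles.OmegaPos Δ s O φ m,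
        Set.encard {x : Σ i : Fin h, QuatCycles.OmegaPlus Δ O φ m (𝔞 i) |
            QuatCycles.conjMap s φ m (x.2 : ℍ[ℚ, α, β]) = ξ} =
          ((Nat.card (𝓞 K)ˣ * QuatCycles.rho K
            (m / (QuatCycles.conductor s O m ξ * QuatCycles.frobeniusType s O θ D φ m ξ * |Δ|)) :
              ℕ) : ℕ∞)) ∧
    ((∀ (i : Fin h), ∀ η ∈ QuatCycles.OmegaMinus Δ O φ m (𝔞 i),
        IsUnit η ∧ QuatCycles.conjMap s φ m η ∈ QuatCycles.OmegaNeg Δ s O φ m) ∧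
      ∀ ξ ∈ QuatCycles.OmegaNeg Δ s O φ m,
        Set.encard {x : Σ i : Fin h, QuatCycles.OmegaMinus Δ O φ m (𝔞 i) |
            QuatCycles.conjMap s φ m (x.2 : ℍ[ℚ, α, β]) = ξ} =
          ((Nat.card (𝓞 K)ˣ * QuatCycles.rho K
            (m / (QuatCycles.conductor s O m ξ * QuatCycles.frobeniusType s O θ D φ m ξ * |Δ|)) :
              ℕ) : ℕ∞)) :=
  mainTheorem4_general Δ hΔneg hΔsq (by obtain ⟨k, rfl⟩ := hΔeven; lia) s hs hK α β hα hβ D hD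
    hinert O hO θ hθ φ hφ m hm 𝔞 h𝔞
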